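/- Let $U\subseteq\mathbb R^n$ be open, identify $T^*U$ with $U\times\mathbb R^n$ with coordinates $(x,\xi)$, use the Euclidean norm, and fix a smooth $\chi$ on $T^*U$ with $\chi=0$ for $|\xi|\le 1/2$ and $\chi=1$ for $|\xi|\ge 1$. *Symbols.* A symbol of real order $r$ on $U$ is an $f\in C^\infty(T^*U)$ such that for all multi-indices $a,b$ and every compact $K\subset U$ there is $C$ with $|\partial_x^a\partial_\xi^b f(x,\xi)|\le C(1+|\xi|)^{r-|b|}$ for $x\in K$, $\xi\in\mathbb R^n$. For $m\in\mathbb C$, $CS^m(U)$ is the set of symbols $f$ of order $\operatorname{Re} m$ for which there are smooth functions $f_{m-j}$ on $U\times(\mathbb R^n\setminus 0)$, positively homogeneous of degree $m-j$ in $\xi$, such that $f-\sum_{j<N}\chi f_{m-j}$ is a symbol of order $\operatorname{Re} m-N$ for every $N$. $CS^m_{com}(U)$ is the subset of those $f$ that vanish for $x$ outside some compact subset of $U$, and $CS_{com}(U)$ is the linear span of $\bigcup_{m\in\mathbb C}CS^m_{com}(U)$. $\Omega^k CS_{com}(U)$ is the space of forms $\omega=\sum_{|I|+|J|=k}\omega_{IJ}\,dx_I\wedge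 d\xi_J$ with $\omega_{IJ}\in CS_{com}(U)$. *Regularisations.* Let $W\subseteq\mathbb C$ be open and connected with $0\in W$ (for instance $W=\mathbb C$). A holomorphic family of order $\alpha$, with $\alpha:W\to\mathbb C$ holomorphic, is a map $z\mapsto\sigma(z)$ on $W$ with $\sigma(z)\in CS_{com}^{\alpha(z)}(U)$, whose homogeneous components $\sigma_{\alpha(z)-j}(z)$ are holomorphic in $z$ with values in $C^\infty(U\times(\mathbb R^n\setminus0))$, and whose remainders $\sigma_{(N)}(z)=\sigma(z)-\sum_{j<N}\chi\,\sigma_{\alpha(z)-j}(z)$, $N\ge1$, are holomorphic in $z$ with values in $C^\infty(T^*U)$, with $\partial_z^k\sigma_{(N)}(z)$ a symbol of order $\operatorname{Re}\alpha(z)-N+\varepsilon$ for all $k\ge0$, $z\in W$ and $\varepsilon>0$. A holomorphic regularisation procedure on $CS_{com}(U)$ is a map $\mathcal R:\sigma\mapsto(z\mapsto\sigma(z))$ with $\sigma(0)=\sigma$ for every $\sigma \in CS_{com}(U)$, which sends every $\sigma\in\bigcup_m CS_{com}^m(U)$ to a holomorphic family of some order $\alpha$ with $\alpha'(0)\ne0$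 (so that $\sigma \in CS^{\alpha(0)}_{com}(U)$), and a general $\sigma\in CS_{com}(U)$ to a finite sum of holomorphic families whose orders $\alpha_i$ satisfy $\alpha_i'(0)\neq0$. It induces the regularisation $\omega(z)=\sum_{I,J}\mathcal R(\omega_{IJ})(z)\,dx_I\wedge d\xi_J$ of forms. *Cut-off integrals.* The finite part $\mathrm{fp}_{R\to\infty}f(R)$ is the constant $c$ in an expansion $f(R)=c+\sum_\mu a_\mu R^\mu+b\log R+o(1)$, a finite sum over exponents $\mu\in\mathbb C\setminus\{0\}$. For a $2n$-form $\alpha=\sigma\,dx_1\wedge\dots\wedge dx_n\wedge d\xi_1\wedge\dots\wedge d\xi_n$ with $\sigma \in CS_{com}(U)$, $$-\!\!\!\!\!\!\int_{T^*U}\alpha=\int_U\Big(\mathrm{fp}_{R\to\infty}\int_{|\xi|<R}\sigma(x,\xi)\,d\xi\Big)dx,$$ and $-\!\!\!\!\!\int_{T^*U}\alpha=0$ for forms of degree $\neq2n$. **Theorem.** Let $\omega\mapsto\omega(z)$ be the regularisation of forms induced by a holomorphic regularisation procedure $\mathcal R$ on $CS_{com}(U)$, and let $\omega\in\Omega^kCS_{com}(U)$,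 $k\ge0$. Then $-\!\!\!\!\!\int_{T^*U}d(\omega(z))$ is well defined for every $z\in W$ (if $d(\omega(z))$ has degree $2n$, the fibrewise finite parts exist and are integrable over $U$), it is a meromorphic function of $z\in W$, and as an equality of meromorphic functions on $W$ $$-\!\!\!\!\!\!\int_{T^*U}d(\omega(z))=0,$$ i.e. it vanishes for all $z\in W$ outside a relatively closed discrete subset of $W$. -/

import Mathlib

open scoped ContDiff Topology

noncomputable section

namespace SymbolForms

/-! ### The cotangent bundle `T*U = U × ℝⁿ` of an open set `U ⊆ ℝⁿ`

A point of `T*U` is a pair `(x, ξ)`; functions on `T*U` are represented by functions on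
`ℝⁿ × ℝⁿ`, and functions with compact support in `x ∈ U` by their extension by zero. -/

/-- `ℝⁿ` with its Euclidean norm. -/
abbrev Eucl (n : ℕ) : Type := EuclideanSpace ℝ (Fin n)

/-- `T*ℝⁿ = ℝⁿ × ℝⁿ`, with points `(x, ξ)`. -/
abbrev Cot (n : ℕ) : Type := Eucl n × Eucl n

/-- The coordinate frame `∂/∂x₁, …, ∂/∂xₙ, ∂/∂ξ₁, …, ∂/∂ξₙ` of `T*ℝⁿ`, in this order. -/
def frame {n : ℕ} (i : Fin (n + n)) : Cot n :=
  Fin.addCases (fun j => ((EuclideanSpace.single j 1 : Eucl n), (0 : Eucl n)))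
    (fun j => ((0 : Eucl n), (EuclideanSpace.single j 1 : Eucl n))) i

/-- The coordinate functions `x₁, …, xₙ, ξ₁, …, ξₙ` on `T*ℝⁿ`, in this order. -/
def coord {n : ℕ} (i : Fin (n + n)) : Cot n →L[ℝ] ℝ :=
  Fin.addCases
    (fun j => (EuclideanSpace.proj j : Eucl n →L[ℝ] ℝ).comp (ContinuousLinearMap.fst ℝ _ _))
    (fun j => (EuclideanSpace.proj j : Eucl n →L[ℝ] ℝ).comp (ContinuousLinearMap.snd ℝ _ _)) i

/-- The partial derivative in the `i`-th coordinate. -/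
def partialD {n : ℕ} (i : Fin (n + n)) (f : Cot n → ℂ) : Cot n → ℂ :=
  fun p => fderiv ℝ f p (frame i)

/-- The iterated partial derivative along a list of coordinates. -/
def iterD {n : ℕ} (L : List (Fin (n + n))) (f : Cot n → ℂ) : Cot n → ℂ :=
  L.foldr partialD f

/-- The number of `ξ`-coordinates in a list of coordinates. -/
def fibreCount {n : ℕ} (L : List (Fin (n + n))) : ℕ :=
  L.countP (fun i => decide (n ≤ i.val))

/-! ### Classical symbols -/

/-- Symbols of real order `r` on `U`: smooth functions on `T*U` with
`|∂_x^α ∂_ξ^β f(x, ξ)| ≤ C (1 + |ξ|)^(r - |β|)` uniformly for `x` in compact subsets of `U`. -/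
def IsSymbol {n : ℕ} (U : Set (Eucl n)) (r : ℝ) (f : Cot n → ℂ) : Prop :=
  ContDiffOn ℝ ∞ f (U ×ˢ Set.univ) ∧
    ∀ L : List (Fin (n + n)), ∀ K : Set (Eucl n), IsCompact K → K ⊆ U →
      ∃ C : ℝ, ∀ x ∈ K, ∀ ξ : Eucl n,
        ‖iterD L f (x, ξ)‖ ≤ C * (1 + ‖ξ‖) ^ (r - (fibreCount L : ℝ))

/-- Smooth functions on `T*U` minus the zero section that are positively homogeneous of complex
degree `m` in `ξ`. -/
def IsHomogeneous {n : ℕ} (U : Set (Eucl n)) (m : ℂ) (h : Cot n → ℂ) : Prop :=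
  ContDiffOn ℝ ∞ h (U ×ˢ {0}ᶜ) ∧
    ∀ x ∈ U, ∀ ξ : Eucl n, ξ ≠ 0 → ∀ t : ℝ, 0 < t → h (x, t • ξ) = (t : ℂ) ^ m * h (x, ξ)

/-- The smooth cut-off functions `χ` on `T*U` that vanish for `|ξ| ≤ 1/2` and equal `1` for
`|ξ| ≥ 1`. -/
def IsExcision {n : ℕ} (U : Set (Eucl n)) (χ : Cot n → ℝ) : Prop :=
  ContDiffOn ℝ ∞ χ (U ×ˢ Set.univ) ∧
    (∀ x ∈ U, ∀ ξ : Eucl n, ‖ξ‖ ≤ 1 / 2 → χ (x, ξ) = 0) ∧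
    ∀ x ∈ U, ∀ ξ : Eucl n, 1 ≤ ‖ξ‖ → χ (x, ξ) = 1

/-- The remainder `f - ∑_{j < N} χ h_j`. -/
def remainder {n : ℕ} (χ : Cot n → ℝ) (f : Cot n → ℂ) (h : ℕ → Cot n → ℂ) (N : ℕ) :
    Cot n → ℂ :=
  fun p => f p - ∑ j ∈ Finset.range N, (χ p : ℂ) * h j p

/-- `CS^m(U)`: classical symbols of complex order `m` on `U`, i.e. symbols with an asymptotic
expansion `f ∼ ∑_j χ f_{m-j}` where `f_{m-j}` is positively homogeneous of degree `m - j`. The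
case `N = 0` says that `f` is a symbol of order `Re m`. -/
def IsClassicalSymbol {n : ℕ} (U : Set (Eucl n)) (χ : Cot n → ℝ) (m : ℂ) (f : Cot n → ℂ) :
    Prop :=
  ∃ h : ℕ → Cot n → ℂ, (∀ j : ℕ, IsHomogeneous U (m - (j : ℂ)) (h j)) ∧
    ∀ N : ℕ, IsSymbol U (m.re - (N : ℝ)) (remainder χ f h N)

/-- `CS_com^m(U)`: classical symbols of order `m` with compact support (in `x`) in `U`, extended
by zero. -/
def CScomOrder {n : ℕ} (U : Set (Eucl n)) (χ : Cot n → ℝ) (m : ℂ) : Set (Cot n → ℂ) :=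
  {f | IsClassicalSymbol U χ m f ∧
    ∃ K : Set (Eucl n), IsCompact K ∧ K ⊆ U ∧ ∀ p : Cot n, p.1 ∉ K → f p = 0}

/-- `CS_com(U)`: the space spanned by the compactly supported classical symbols of all complex
orders. -/
def CScom {n : ℕ} (U : Set (Eucl n)) (χ : Cot n → ℝ) : Submodule ℂ (Cot n → ℂ) :=
  Submodule.span ℂ (⋃ m : ℂ, CScomOrder U χ m)

/-! ### Holomorphic families and holomorphic regularisations -/

/-- `z ↦ f z` is a holomorphic map from the open set `W ⊆ ℂ` to the Fréchet space `C^∞(Ω)`, for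
`Ω` open: `f z p` is smooth in `(z, p)` jointly, and holomorphic in `z` for every `p`. -/
def IsHolomorphicInto {n : ℕ} (W : Set ℂ) (Ω : Set (Cot n)) (f : ℂ → Cot n → ℂ) : Prop :=
  ContDiffOn ℝ ∞ (fun q : ℂ × Cot n => f q.1 q.2) (W ×ˢ Ω) ∧
    ∀ p ∈ Ω, DifferentiableOn ℂ (fun z => f z p) W

/-- Holomorphic families `z ↦ σ z`, `z ∈ W`, of compactly supported classical symbols, with
holomorphic order `α`: the positively homogeneous components `h j z` of degree `α z - j` are
holomorphic in `z`, and for `N ≥ 1` the remainder `σ z - ∑_{j < N} χ h j z` is holomorphic in `z`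
with values in `C^∞(T*U)`, its `k`-th `z`-derivative being a symbol of order `α z - N + ε` for
every `ε > 0`. -/
def IsHolomorphicFamily {n : ℕ} (U : Set (Eucl n)) (χ : Cot n → ℝ) (W : Set ℂ) (α : ℂ → ℂ)
    (σ : ℂ → Cot n → ℂ) : Prop :=
  DifferentiableOn ℂ α W ∧
  (∀ z ∈ W, σ z ∈ CScomOrder U χ (α z)) ∧
  ∃ h : ℕ → ℂ → Cot n → ℂ,
    (∀ j : ℕ, (∀ z ∈ W, IsHomogeneous U (α z - (j : ℂ)) (h j z)) ∧
      IsHolomorphicInto W (U ×ˢ {0}ᶜ) (h j)) ∧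
    ∀ N : ℕ, 1 ≤ N →
      IsHolomorphicInto W (U ×ˢ Set.univ)
        (fun z => remainder χ (σ z) (fun j => h j z) N) ∧
      ∀ k : ℕ, ∀ z ∈ W, ∀ ε : ℝ, 0 < ε →
        IsSymbol U ((α z).re - (N : ℝ) + ε)
          (fun p => iteratedDeriv k (fun w => remainder χ (σ w) (fun j => h j w) N p) z)

/-- A holomorphic regularisation procedure `σ ↦ R σ = (z ↦ σ(z))` on `CS_com(U)`, with parameter
`z ∈ W`. A symbol that has an order is sent to a holomorphic family with a holomorphic order `α`,
`α' 0 ≠ 0`; as `σ(0) = σ`, the number `α 0` is then an order of `σ`. A general element of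
`CS_com(U)`, which is a finite sum of symbols of possibly unrelated orders, is sent to a finite
sum of such families. No linearity is required. -/
structure IsHolomorphicRegularisation {n : ℕ} (U : Set (Eucl n)) (χ : Cot n → ℝ) (W : Set ℂ)
    (R : (Cot n → ℂ) → ℂ → Cot n → ℂ) : Prop where
  map_zero : ∀ σ ∈ CScom U χ, R σ 0 = σ
  of_order : ∀ m : ℂ, ∀ σ ∈ CScomOrder U χ m,
    ∃ α : ℂ → ℂ, IsHolomorphicFamily U χ W α (R σ) ∧ deriv α 0 ≠ 0
  of_sum : ∀ σ ∈ CScom U χ, ∃ (r : ℕ) (α : Fin r → ℂ → ℂ) (τ : Fin r → ℂ → Cot n → ℂ),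
    (∀ i, IsHolomorphicFamily U χ W (α i) (τ i) ∧ deriv (α i) 0 ≠ 0) ∧
    ∀ z ∈ W, R σ z = ∑ i, τ i z

/-! ### Symbol valued forms -/

/-- Complex valued differential `k`-forms on `T*ℝⁿ`. -/
abbrev Form (n k : ℕ) : Type := Cot n → Cot n [⋀^Fin k]→L[ℝ] ℂ

/-- The coefficient of `dx_I ∧ dξ_J` in a `k`-form; a pair `(I, J)` with `|I| + |J| = k` is
encoded by the strictly increasing enumeration `a` of the corresponding `k` coordinates among
`x₁, …, xₙ, ξ₁, …, ξₙ`. -/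
def coeff {n k : ℕ} (θ : Form n k) (a : Fin k → Fin (n + n)) : Cot n → ℂ :=
  fun p => θ p (fun i => frame (a i))

/-- The constant form `dx_I ∧ dξ_J`: its value on `v₁, …, v_k` is `det (coord (a i) (v_j))`. -/
def elementaryForm {n k : ℕ} (a : Fin k → Fin (n + n)) : Cot n [⋀^Fin k]→L[ℝ] ℂ :=
  ContinuousMultilinearMap.alternatization
    ((ContinuousMultilinearMap.mkPiAlgebra ℝ (Fin k) ℂ).compContinuousLinearMap
      (fun i => Complex.ofRealCLM.comp (coord (a i))))

/-- `Ω^k CS_com(U)`: the `k`-forms `∑ θ_{IJ} dx_I ∧ dξ_J` with all `θ_{IJ}` in `CS_com(U)`. -/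
def OmegaCScom {n : ℕ} (U : Set (Eucl n)) (χ : Cot n → ℝ) (k : ℕ) : Set (Form n k) :=
  {θ | ∀ a : Fin k → Fin (n + n), StrictMono a → coeff θ a ∈ CScom U χ}

open Classical in
/-- The regularisation of forms induced by one of symbols:
`θ(z) = ∑_{I, J} R(θ_{IJ})(z) dx_I ∧ dξ_J`. -/
def inducedRegularisation {n k : ℕ} (R : (Cot n → ℂ) → ℂ → Cot n → ℂ) (θ : Form n k) (z : ℂ) :
    Form n k :=
  fun p => ∑ a : Fin k → Fin (n + n) with StrictMono a,
    R (coeff θ a) z p • elementaryForm a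

/-! ### Cut-off integrals -/

/-- `c` is the finite part at infinity of `f`: as `R → ∞`,
`f R = c + ∑ a_μ R^μ + b log R + o(1)`, a finite sum over non-zero complex exponents `μ`. -/
def HasFinitePart (f : ℝ → ℂ) (c : ℂ) : Prop :=
  ∃ (s : Finset ℂ) (a : ℂ → ℂ) (b : ℂ), (0 : ℂ) ∉ s ∧
    Filter.Tendsto
      (fun R : ℝ => f R - ∑ μ ∈ s, a μ * (R : ℂ) ^ μ - b * (Real.log R : ℂ))
      Filter.atTop (𝓝 c)

open Classical in
/-- The finite part `fp_{R → ∞} f R`. -/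
def finitePart (f : ℝ → ℂ) : ℂ :=
  if h : ∃ c, HasFinitePart f c then h.choose else 0

/-- `∫_{|ξ| < R} σ(x, ξ) dξ`, as a function of `R`. -/
def ballIntegral {n : ℕ} (σ : Cot n → ℂ) (x : Eucl n) (R : ℝ) : ℂ :=
  ∫ ξ in Metric.ball (0 : Eucl n) R, σ (x, ξ)

/-- The cut-off integral over the fibre `T_x^*U`. -/
def fibreCutoffIntegral {n : ℕ} (σ : Cot n → ℂ) (x : Eucl n) : ℂ :=
  finitePart (ballIntegral σ x)

/-- The coefficient of `dx₁ ∧ ⋯ ∧ dxₙ ∧ dξ₁ ∧ ⋯ ∧ dξₙ` in a form of top degree. -/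
def topCoeff {n k : ℕ} (h : k = n + n) (θ : Form n k) : Cot n → ℂ :=
  coeff θ (Fin.cast h)

/-- The cut-off integral of a form over `T*U` makes sense: for a form of top degree all fibrewise
finite parts exist, and they are integrable over `U`. -/
def CutoffIntegrable {n k : ℕ} (U : Set (Eucl n)) (θ : Form n k) : Prop :=
  ∀ h : k = n + n,
    (∀ x ∈ U, ∃ c, HasFinitePart (ballIntegral (topCoeff h θ) x) c) ∧
    MeasureTheory.IntegrableOn (fibreCutoffIntegral (topCoeff h θ)) U

/-- The cut-off integral of a `k`-form over `T*U`: for `k = 2n` it is the integral over `x ∈ U` of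
the fibrewise cut-off integrals of the top coefficient; it is zero for `k ≠ 2n`. -/
def cutoffIntegral {n k : ℕ} (U : Set (Eucl n)) (θ : Form n k) : ℂ :=
  if h : k = n + n then ∫ x in U, fibreCutoffIntegral (topCoeff h θ) x else 0

end SymbolForms

end

/-!
Why the cut-off integral of `d (ω(z))` vanishes. Only top degree matters, and there the coefficient
of `d (ω(z))` is a linear combination with constant coefficients of derivatives `∂ᵢ τ(z)`, where
`τ(z)` is a compactly supported classical symbol of order `α z` and `α` is a non-constant
holomorphic function (`topCoeff_extDeriv_sum`). So it is enough to treat `∂ᵢ f` for one classical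
symbol `f` of order `m`, which is done in `exists_hasCutoffIntegral_partialD`.

Existence. For `|ξ| ≥ 2` the function `∂ᵢ f` is a finite sum of homogeneous functions and of a
remainder that is integrable on the fibres. In polar coordinates, the integral over `|ξ| < R` is
a sum of powers of `R`, a logarithm, a constant and a tail tending to zero, with coefficients that
are continuous in `x` and a tail that is small locally uniformly in `x`
(`HasFibreExpansion.exists_hasFinitePart`). The constant term is well defined because exponentials
`exp (μ t)`, `μ ≠ 0`, cannot cancel a polynomial at infinity (`HasFinitePart.unique`).

Horizontal derivatives. By uniformity in `x`, the integral over the base of the finite parts is the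
finite part of the integral over the base of the ball integrals. By Fubini's theorem the latter
is zero for every `R`, as `f` has compact support in `x`.

Vertical derivatives. On each fibre, the integral of `∂f/∂ξ_j` over `|ξ| < R` is a boundary term.
It is written as an integral over `|ξ| ≥ R` by means of a bump function dilated by `R`, so that
no integration over spheres is needed; by homogeneity it is a sum of powers `R ^ (m - l - 1 + n)`,
`l = 0, 1, …`, up to `o(1)` (`hasFinitePart_setIntegral_fderiv`). Hence its finite part is zero
unless `m` is one of the integers `l + 1 - n`.

Since `α` is not constant on the connected set `W`, the parameters `z` for which `α z` is one of
these integers form a discrete set (`codiscreteWithin_order_ne`). Outside of it the cut-off integral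
is zero, and it is meromorphic because it vanishes on a punctured neighbourhood of every point.
-/

noncomputable section

namespace SymbolForms

open Filter MeasureTheory

/-! ### Finite parts at infinity -/

/-- The exponentials `t ↦ exp (μ t)`, `μ ≠ 0`, cannot cancel a polynomial `b t + c` at infinity.
Induction on the number of exponents: the operator `g ↦ g (t + h) - exp (μ h) g t` removes the
exponent `μ`, and it is injective on the polynomials `b t + c` as soon as `exp (μ h) ≠ 1`. -/
lemma eq_zero_of_tendsto_expSum (s : Finset ℂ) (hs : (0 : ℂ) ∉ s) :
    ∀ (a : ℂ → ℂ) (b c : ℂ),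
      Tendsto (fun t : ℝ => c + b * t + ∑ μ ∈ s, a μ * Complex.exp (μ * t)) atTop (𝓝 0) →
      b = 0 ∧ c = 0 := by
  induction s using Finset.induction_on with
  | empty =>
    intro a b c h
    simp only [Finset.sum_empty, add_zero] at h
    have h1 : Tendsto (fun t : ℝ => (c + b * ((t + 1 : ℝ) : ℂ)) - (c + b * t)) atTop (𝓝 (0 - 0)) :=
      (h.comp (tendsto_atTop_add_const_right _ 1 tendsto_id)).sub h
    have hb : b = 0 := by
      refine tendsto_nhds_unique (tendsto_const_nhds (x := b) (f := atTop (α := ℝ))) ?_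
      convert h1 using 2
      · push_cast; ring
      · simp
    subst hb
    simpa using h
  | insert μ s hμ ih =>
    intro a b c h
    simp only [Finset.mem_insert, not_or] at hs
    have hμ0 : μ ≠ 0 := fun h => hs.1 h.symm
    -- a shift `δ` small enough for `exp (μ δ) ≠ 1`
    obtain ⟨δ, hδ⟩ : ∃ δ : ℝ, Complex.exp (μ * δ) ≠ 1 := by
      by_contra! hcon
      have hd : HasDerivAt (fun t : ℝ => Complex.exp (μ * t)) μ 0 := by
        have := ((Complex.ofRealCLM.hasDerivAt (x := (0 : ℝ))).const_mul μ).cexp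
        simpa using this
      have : (fun t : ℝ => Complex.exp (μ * t)) = fun _ => 1 := funext hcon
      rw [this] at hd
      exact hμ0 (hd.unique (hasDerivAt_const _ _))
    set q := Complex.exp (μ * δ) with hq
    have h1 := (h.comp (tendsto_atTop_add_const_right _ δ tendsto_id)).sub (h.const_mul q)
    have h2 := ih hs.2 (fun ν => a ν * (Complex.exp (ν * δ) - q)) (b * (1 - q))
      (c * (1 - q) + b * δ) (by
        convert h1 using 2 with t
        · simp only [Function.comp, id]
          rw [Finset.sum_insert hμ, Finset.sum_insert hμ]
          have e1 : ∀ ν : ℂ, Complex.exp (ν * ((t + δ : ℝ) : ℂ)) =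
              Complex.exp (ν * δ) * Complex.exp (ν * t) := by
            intro ν; rw [← Complex.exp_add]; congr 1; push_cast; ring
          simp only [e1, ← hq]
          have e2 : ∑ ν ∈ s, a ν * (Complex.exp (ν * δ) - q) * Complex.exp (ν * t) =
              ∑ ν ∈ s, a ν * (Complex.exp (ν * δ) * Complex.exp (ν * t)) -
                q * ∑ ν ∈ s, a ν * Complex.exp (ν * t) := by
            rw [Finset.mul_sum, ← Finset.sum_sub_distrib]
            exact Finset.sum_congr rfl fun ν _ => by ring
          rw [e2]; push_cast; ring
        · simp)
    have hq1 : (1 - q) ≠ 0 := sub_ne_zero.2 (Ne.symm hδ)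
    have hb : b = 0 := (mul_eq_zero.1 h2.1).resolve_right hq1
    have hc := h2.2
    rw [hb] at hc
    exact ⟨hb, by simpa [hq1] using hc⟩

lemma HasFinitePart.congr {f g : ℝ → ℂ} {c : ℂ} (hf : HasFinitePart f c) (h : f =ᶠ[atTop] g) :
    HasFinitePart g c := by
  obtain ⟨s, a, b, h0, ht⟩ := hf
  exact ⟨s, a, b, h0, ht.congr' (h.mono fun R hR => by simp only [hR])⟩

lemma HasFinitePart.add {f g : ℝ → ℂ} {c d : ℂ} (hf : HasFinitePart f c)
    (hg : HasFinitePart g d) : HasFinitePart (fun R => f R + g R) (c + d) := by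
  classical
  obtain ⟨s, a, b, h0, ht⟩ := hf
  obtain ⟨s', a', b', h0', ht'⟩ := hg
  refine ⟨s ∪ s', fun μ => (if μ ∈ s then a μ else 0) + (if μ ∈ s' then a' μ else 0), b + b',
    by simp [h0, h0'], (ht.add ht').congr fun R => ?_⟩
  simp only [add_mul, Finset.sum_add_distrib, ite_mul, zero_mul, Finset.sum_ite_mem,
    Finset.union_inter_cancel_left, Finset.union_inter_cancel_right]
  ring

lemma HasFinitePart.const_mul {f : ℝ → ℂ} {c : ℂ} (hf : HasFinitePart f c) (k : ℂ) :
    HasFinitePart (fun R => k * f R) (k * c) := by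
  obtain ⟨s, a, b, h0, ht⟩ := hf
  refine ⟨s, fun μ => k * a μ, k * b, h0, (ht.const_mul k).congr fun R => ?_⟩
  simp only [mul_sub, Finset.mul_sum, mul_assoc]

lemma hasFinitePart_of_tendsto {f : ℝ → ℂ} {c : ℂ} (h : Tendsto f atTop (𝓝 c)) :
    HasFinitePart f c :=
  ⟨∅, 0, 0, by simp, by simpa using h⟩

lemma HasFinitePart.sum {ι : Type*} (s : Finset ι) {f : ι → ℝ → ℂ} {c : ι → ℂ}
    (h : ∀ i ∈ s, HasFinitePart (f i) (c i)) :
    HasFinitePart (fun R => ∑ i ∈ s, f i R) (∑ i ∈ s, c i) := by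
  classical
  induction s using Finset.induction_on with
  | empty => simpa using hasFinitePart_of_tendsto (tendsto_const_nhds (x := (0 : ℂ)))
  | insert i s hi ih =>
    simp only [Finset.sum_insert hi]
    exact (h i (by simp)).add (ih fun j hj => h j (by simp [hj]))

lemma hasFinitePart_cpow {w : ℂ} (hw : w ≠ 0) : HasFinitePart (fun R : ℝ => (R : ℂ) ^ w) 0 :=
  ⟨{w}, 1, 0, by simpa using hw.symm, by simp⟩

lemma hasFinitePart_log : HasFinitePart (fun R : ℝ => (Real.log R : ℂ)) 0 :=
  ⟨∅, 0, 1, by simp, by simp⟩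

/-- The finite part is unique. -/
lemma HasFinitePart.unique {f : ℝ → ℂ} {c d : ℂ} (hf : HasFinitePart f c)
    (hg : HasFinitePart f d) : c = d := by
  obtain ⟨s, a, b, h0, ht⟩ := (hf.add (hg.const_mul (-1)))
  have ht1 := (ht.const_sub (c + -1 * d)).comp Real.tendsto_exp_atTop
  have := eq_zero_of_tendsto_expSum s h0 a b (c + -1 * d) (by
    convert ht1 using 2 with t
    · simp only [Function.comp, Real.log_exp]
      have e : ∀ μ : ℂ, ((Real.exp t : ℝ) : ℂ) ^ μ = Complex.exp (μ * t) := by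
        intro μ
        rw [Complex.cpow_def_of_ne_zero (by exact_mod_cast (Real.exp_pos t).ne'),
          ← Complex.ofReal_log (Real.exp_pos t).le, Real.log_exp, mul_comm]
      simp only [e]; ring
    · simp)
  linear_combination this.2

lemma HasFinitePart.finitePart_eq {f : ℝ → ℂ} {c : ℂ} (hf : HasFinitePart f c) :
    finitePart f = c := by
  have h : ∃ c, HasFinitePart f c := ⟨c, hf⟩
  rw [finitePart, dif_pos h]
  exact h.choose_spec.unique hf

/-! ### Integrals of homogeneous functions over annuli -/

/-- The integral `∫_2^R t ^ (w - 1) dt` by which the integral over the annulus `2 ≤ |ξ| < R` of a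
function that is homogeneous of degree `w - n` depends on `R`. -/
def radialIntegral (w : ℂ) (R : ℝ) : ℂ := ∫ t in Set.Ico 2 R, (t : ℂ) ^ (w - 1)

/-- The radial integral is `(R ^ w - 2 ^ w) / w`, or `log (R / 2)` if `w = 0`. -/
lemma exists_hasFinitePart_radialIntegral (w : ℂ) : ∃ c, HasFinitePart (radialIntegral w) c := by
  have key : ∀ R : ℝ, 2 ≤ R → radialIntegral w R = ∫ t in (2 : ℝ)..R, (t : ℂ) ^ (w - 1) := by
    intro R hR
    rw [radialIntegral, intervalIntegral.integral_of_le hR, integral_Ico_eq_integral_Ioc]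
  have hmem : ∀ R : ℝ, 2 ≤ R → (0 : ℝ) ∉ Set.uIcc 2 R := by
    intro R hR
    rw [Set.uIcc_of_le hR]
    simp
  by_cases hw : w = 0
  · subst hw
    refine ⟨_, (hasFinitePart_log.add (hasFinitePart_of_tendsto
      (tendsto_const_nhds (x := (-Real.log 2 : ℂ))))).congr ?_⟩
    filter_upwards [eventually_ge_atTop 2] with R hR
    rw [key R hR]
    have : ∀ t : ℝ, (t : ℂ) ^ ((0 : ℂ) - 1) = ((t⁻¹ : ℝ) : ℂ) := by
      intro t; rw [zero_sub, Complex.cpow_neg_one]; push_cast; rfl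
    simp only [this]
    rw [intervalIntegral.integral_ofReal, integral_inv_of_pos (by norm_num) (by linarith),
      Real.log_div (by linarith) (by norm_num)]
    push_cast; ring
  · refine ⟨_, (((hasFinitePart_cpow hw).const_mul w⁻¹).add (hasFinitePart_of_tendsto
      (tendsto_const_nhds (x := (-(2 : ℂ) ^ w / w))))).congr ?_⟩
    filter_upwards [eventually_ge_atTop 2] with R hR
    rw [key R hR, integral_cpow (Or.inr ⟨fun h => hw (by linear_combination h), hmem R hR⟩)]
    simp only [sub_add_cancel, Complex.ofReal_ofNat]
    field_simp
    ring

/-- Integration in polar coordinates of a homogeneous function. -/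
lemma setIntegral_annulus_of_homogeneous {n : ℕ} [NeZero n] (s : ℂ) (H : Eucl n → ℂ)
    (hH : ∀ ξ, ξ ≠ 0 → ∀ t : ℝ, 0 < t → H (t • ξ) = (t : ℂ) ^ s * H ξ) (R : ℝ) :
    ∫ ξ in Metric.ball 0 R \ Metric.ball 0 2, H ξ =
      (∫ η : Metric.sphere (0 : Eucl n) 1, H η ∂(volume : Measure (Eucl n)).toSphere) *
        radialIntegral (s + n) R := by
  have hn : n ≠ 0 := NeZero.ne n
  have : Nontrivial (Eucl n) := by
    have : Nonempty (Fin n) := ⟨⟨0, Nat.pos_of_ne_zero hn⟩⟩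
    infer_instance
  set μ : Measure (Eucl n) := volume
  have hdim : Module.finrank ℝ (Eucl n) = n := by simp
  set S : Set (Eucl n) := Metric.ball 0 R \ Metric.ball 0 2 with hS
  have hSm : MeasurableSet S := measurableSet_ball.diff measurableSet_ball
  let u : Metric.sphere (0 : Eucl n) 1 → ℂ := fun η => H η
  let v : ℝ → ℂ := (Set.Ico 2 R).indicator fun t => (t : ℂ) ^ s
  have h1 : ∀ p : ({(0)}ᶜ : Set (Eucl n)), S.indicator H p =
      (fun q : Metric.sphere (0 : Eucl n) 1 × Set.Ioi (0 : ℝ) => u q.1 * v q.2)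
        (homeomorphUnitSphereProd (Eucl n) p) := by
    rintro ⟨ξ, hξ⟩
    have hξ0 : ξ ≠ 0 := hξ
    have hpos : 0 < ‖ξ‖ := norm_pos_iff.2 hξ0
    have hmem : ξ ∈ S ↔ ‖ξ‖ ∈ Set.Ico 2 R := by
      simp [hS, and_comm]
    simp only [u, v, homeomorphUnitSphereProd_apply_fst_coe, homeomorphUnitSphereProd_apply_snd_coe]
    by_cases hm : ξ ∈ S
    · rw [Set.indicator_of_mem hm, Set.indicator_of_mem (hmem.1 hm)]
      have := hH (‖ξ‖⁻¹ • ξ) (smul_ne_zero (inv_ne_zero hpos.ne') hξ0) ‖ξ‖ hpos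
      rw [smul_smul, mul_inv_cancel₀ hpos.ne', one_smul] at this
      rw [this, mul_comm]
    · rw [Set.indicator_of_notMem hm, Set.indicator_of_notMem (fun h => hm (hmem.2 h)), mul_zero]
  calc ∫ ξ in S, H ξ = ∫ ξ, S.indicator H ξ ∂μ := (integral_indicator hSm).symm
    _ = ∫ p : ({(0)}ᶜ : Set (Eucl n)), S.indicator H p ∂(μ.comap (↑)) := by
      rw [integral_subtype_comap (measurableSet_singleton _).compl (S.indicator H),
        restrict_compl_singleton]
    _ = ∫ q : Metric.sphere (0 : Eucl n) 1 × Set.Ioi (0 : ℝ), u q.1 * v q.2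
          ∂μ.toSphere.prod (.volumeIoiPow (Module.finrank ℝ (Eucl n) - 1)) := by
      simp only [h1]
      exact μ.measurePreserving_homeomorphUnitSphereProd.integral_comp
        (Homeomorph.measurableEmbedding _)
        (fun q : Metric.sphere (0 : Eucl n) 1 × Set.Ioi (0 : ℝ) => u q.1 * v q.2)
    _ = (∫ η, u η ∂μ.toSphere) *
          ∫ t : Set.Ioi (0 : ℝ), v t ∂.volumeIoiPow (Module.finrank ℝ (Eucl n) - 1) :=
      integral_prod_mul u fun t : Set.Ioi (0 : ℝ) => v t
    _ = _ := by
      congr 1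
      simp only [Measure.volumeIoiPow, ENNReal.ofReal]
      rw [integral_withDensity_eq_integral_smul
          (measurable_subtype_coe.pow_const _).real_toNNReal,
        integral_subtype_comap measurableSet_Ioi
          fun t => Real.toNNReal (t ^ (Module.finrank ℝ (Eucl n) - 1)) • v t, hdim,
        radialIntegral, ← integral_indicator measurableSet_Ioi,
        ← integral_indicator measurableSet_Ico]
      congr 1
      ext t
      by_cases ht : t ∈ Set.Ico 2 R
      · have ht0 : 0 < t := by linarith [ht.1]
        rw [Set.indicator_of_mem (Set.mem_Ioi.2 ht0), Set.indicator_of_mem ht]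
        simp only [v, Set.indicator_of_mem ht]
        rw [NNReal.smul_def, Real.coe_toNNReal _ (pow_nonneg ht0.le _), Complex.real_smul]
        push_cast
        rw [← Complex.cpow_natCast, ← Complex.cpow_add _ _ (by exact_mod_cast ht0.ne')]
        congr 1
        rw [Nat.cast_sub (Nat.one_le_iff_ne_zero.2 hn)]
        push_cast; ring
      · rw [Set.indicator_of_notMem ht]
        simp [v, Set.indicator_of_notMem ht, Set.indicator]

/-! ### Integrals depending on a parameter -/

/-- An integral is continuous in a parameter if the integrand is continuous, and dominated locally
uniformly in the parameter. -/
lemma continuousOn_setIntegral_of_dominated {X Y : Type*} [TopologicalSpace X]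
    [FirstCountableTopology X] [LocallyCompactSpace X] [TopologicalSpace Y]
    [MeasurableSpace Y] [OpensMeasurableSpace Y] {μ : Measure Y} {U : Set X} (hU : IsOpen U)
    {T : Set Y} (hT : MeasurableSet T) {F : X × Y → ℂ} (hF : ContinuousOn F (U ×ˢ T))
    (hb : ∀ K : Set X, IsCompact K → K ⊆ U →
      ∃ b : Y → ℝ, IntegrableOn b T μ ∧ ∀ x ∈ K, ∀ y ∈ T, ‖F (x, y)‖ ≤ b y) :
    ContinuousOn (fun x => ∫ y in T, F (x, y) ∂μ) U := by
  intro x hx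
  obtain ⟨K, hKn, hKU, hK⟩ := local_compact_nhds (hU.mem_nhds hx)
  obtain ⟨b, hbi, hbb⟩ := hb K hK hKU
  refine continuousWithinAt_of_dominated (bound := b) ?_ ?_ hbi ?_
  · filter_upwards [self_mem_nhdsWithin] with y hy
    exact (hF.comp (by fun_prop) fun t ht => ⟨hy, ht⟩).aestronglyMeasurable hT
  · filter_upwards [mem_nhdsWithin_of_mem_nhds hKn] with y hy
    filter_upwards [ae_restrict_mem hT] with t ht using hbb y hy t ht
  · filter_upwards [ae_restrict_mem hT] with t ht
    exact hF.comp (by fun_prop) (fun y hy => ⟨hy, ht⟩) x hx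

lemma continuousOn_setIntegral_of_isCompact {X Y : Type*} [TopologicalSpace X]
    [FirstCountableTopology X] [LocallyCompactSpace X] [TopologicalSpace Y]
    [MeasurableSpace Y] [OpensMeasurableSpace Y] {μ : Measure Y} [IsFiniteMeasureOnCompacts μ]
    {U : Set X} (hU : IsOpen U)
    {T : Set Y} (hTm : MeasurableSet T) (hT : IsCompact T) {F : X × Y → ℂ}
    (hF : ContinuousOn F (U ×ˢ T)) :
    ContinuousOn (fun x => ∫ y in T, F (x, y) ∂μ) U := by
  refine continuousOn_setIntegral_of_dominated hU hTm hF fun K hK hKU => ?_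
  obtain ⟨C, hC⟩ := (hK.prod hT).exists_bound_of_continuousOn
    (hF.mono (Set.prod_mono_left hKU))
  exact ⟨fun _ => C, integrableOn_const hT.measure_lt_top.ne, fun x hx y hy => hC _ ⟨hx, hy⟩⟩

/-- The integral over `|ξ| ≥ R` of an integrable function tends to zero as `R → ∞`. -/
lemma tendsto_setIntegral_compl_ball {E F : Type*} [NormedAddCommGroup E] [MeasurableSpace E]
    [OpensMeasurableSpace E] [NormedAddCommGroup F] [NormedSpace ℝ F] {μ : Measure E} {f : E → F}
    (hf : Integrable f μ) :
    Tendsto (fun R : ℝ => ∫ ξ in (Metric.ball 0 R)ᶜ, f ξ ∂μ) atTop (𝓝 0) := by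
  have h := tendsto_setIntegral_of_antitone (μ := μ) (f := f)
    (s := fun R : ℝ => (Metric.ball (0 : E) R)ᶜ) (fun R => measurableSet_ball.compl)
    (fun R S h => Set.compl_subset_compl.2 (Metric.ball_subset_ball h)) ⟨0, hf.integrableOn⟩
  have h0 : (⋂ R : ℝ, (Metric.ball (0 : E) R)ᶜ) = ∅ := by
    ext ξ
    simp only [Set.mem_iInter, Set.mem_compl_iff, Metric.mem_ball, dist_zero_right, not_lt,
      Set.mem_empty_iff_false, iff_false, not_forall, not_le]
    exact ⟨‖ξ‖ + 1, by linarith⟩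
  simpa [h0] using h

/-! ### Cut-off integrals of functions with an expansion on the fibres -/

/-- Continuous functions `g` on `T*U` that, for `|ξ| ≥ 2`, are the sum of `N` functions `k j`,
homogeneous of degree `s j` in `ξ`, and a remainder `ρ` of order `r < -n`, hence integrable on the
fibres. -/
structure HasFibreExpansion {n : ℕ} (U : Set (Eucl n)) (g : Cot n → ℂ) (N : ℕ) (s : ℕ → ℂ)
    (k : ℕ → Cot n → ℂ) (ρ : Cot n → ℂ) (r : ℝ) : Prop where
  continuousOn : ContinuousOn g (U ×ˢ Set.univ)
  continuousOn_component : ∀ j, ContinuousOn (k j) (U ×ˢ {0}ᶜ)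
  homogeneous : ∀ j, ∀ x ∈ U, ∀ ξ : Eucl n, ξ ≠ 0 → ∀ t : ℝ, 0 < t →
    k j (x, t • ξ) = (t : ℂ) ^ s j * k j (x, ξ)
  continuousOn_remainder : ContinuousOn ρ (U ×ˢ Set.univ)
  decay : ∀ K : Set (Eucl n), IsCompact K → K ⊆ U → ∃ C : ℝ, ∀ x ∈ K, ∀ ξ : Eucl n,
    ‖ρ (x, ξ)‖ ≤ C * (1 + ‖ξ‖) ^ r
  order_lt : r < -n
  eq : ∀ x ∈ U, ∀ ξ : Eucl n, 2 ≤ ‖ξ‖ → g (x, ξ) = ∑ j ∈ Finset.range N, k j (x, ξ) + ρ (x, ξ)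

lemma integrable_one_add_norm_rpow {n : ℕ} {r : ℝ} (hr : r < -n) :
    Integrable (fun ξ : Eucl n => (1 + ‖ξ‖) ^ r) := by
  have := integrable_one_add_norm (E := Eucl n) (μ := volume) (r := -r)
    (by rw [finrank_euclideanSpace_fin]; linarith)
  simpa using this

lemma integrableOn_fibre {n : ℕ} {U : Set (Eucl n)} {g : Cot n → ℂ}
    (hg : ContinuousOn g (U ×ˢ Set.univ)) {x : Eucl n} (hx : x ∈ U) (R : ℝ) :
    IntegrableOn (fun ξ => g (x, ξ)) (Metric.ball 0 R) := by
  have : Continuous fun ξ => g (x, ξ) :=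
    hg.comp_continuous (by fun_prop) fun ξ => ⟨hx, trivial⟩
  exact (this.continuousOn.integrableOn_compact (isCompact_closedBall 0 R)).mono_set
    Metric.ball_subset_closedBall

namespace HasFibreExpansion

variable {n : ℕ} {U : Set (Eucl n)} {g : Cot n → ℂ} {N : ℕ} {s : ℕ → ℂ} {k : ℕ → Cot n → ℂ}
  {ρ : Cot n → ℂ} {r : ℝ}

lemma integrable_remainder (h : HasFibreExpansion U g N s k ρ r) {x : Eucl n} (hx : x ∈ U) :
    Integrable (fun ξ => ρ (x, ξ)) := by
  obtain ⟨C, hC⟩ := h.decay {x} isCompact_singleton (by simpa using hx)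
  refine ((integrable_one_add_norm_rpow h.order_lt).const_mul C).mono'
    (Continuous.aestronglyMeasurable ?_) (ae_of_all _ fun ξ => hC x rfl ξ)
  exact h.continuousOn_remainder.comp_continuous (by fun_prop) fun ξ => ⟨hx, trivial⟩

lemma ballIntegral_eq [NeZero n] (h : HasFibreExpansion U g N s k ρ r) {x : Eucl n} (hx : x ∈ U)
    {R : ℝ} (hR : 2 ≤ R) :
    ballIntegral g x R = (∫ ξ in Metric.ball 0 2, g (x, ξ)) +
      ∑ j ∈ Finset.range N, (∫ η : Metric.sphere (0 : Eucl n) 1, k j (x, η)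
        ∂(volume : Measure (Eucl n)).toSphere) * radialIntegral (s j + n) R +
      (∫ ξ in (Metric.ball 0 2)ᶜ, ρ (x, ξ)) - ∫ ξ in (Metric.ball 0 R)ᶜ, ρ (x, ξ) := by
  have hsub : Metric.ball (0 : Eucl n) 2 ⊆ Metric.ball 0 R := Metric.ball_subset_ball hR
  set S : Set (Eucl n) := Metric.ball 0 R \ Metric.ball 0 2 with hS
  have hSm : MeasurableSet S := measurableSet_ball.diff measurableSet_ball
  have hρ := h.integrable_remainder hx
  have h1 : ballIntegral g x R =
      (∫ ξ in Metric.ball 0 2, g (x, ξ)) + ∫ ξ in S, g (x, ξ) := by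
    rw [ballIntegral, ← setIntegral_union Set.disjoint_sdiff_right hSm
      (integrableOn_fibre h.continuousOn hx 2)
      ((integrableOn_fibre h.continuousOn hx R).mono_set Set.sdiff_subset),
      Set.union_sdiff_cancel hsub]
  have hk : ∀ j, IntegrableOn (fun ξ => k j (x, ξ)) S := by
    intro j
    have hc : IsCompact (Metric.closedBall (0 : Eucl n) R \ Metric.ball 0 2) :=
      (isCompact_closedBall 0 R).diff Metric.isOpen_ball
    refine (ContinuousOn.integrableOn_compact hc ?_).mono_set
      (Set.sdiff_subset_sdiff_left Metric.ball_subset_closedBall)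
    refine (h.continuousOn_component j).comp (by fun_prop) fun ξ hξ => ⟨hx, ?_⟩
    rintro (rfl : ξ = 0)
    simp at hξ
  have h2 : ∫ ξ in S, g (x, ξ) =
      ∑ j ∈ Finset.range N, (∫ ξ in S, k j (x, ξ)) + ∫ ξ in S, ρ (x, ξ) := by
    rw [← integral_finsetSum _ fun j _ => hk j, ← integral_add
      (integrable_finsetSum _ fun j _ => hk j) hρ.integrableOn]
    refine setIntegral_congr_fun hSm fun ξ hξ => h.eq x hx ξ ?_
    simpa [hS] using hξ.2
  have h3 : ∫ ξ in (Metric.ball 0 2)ᶜ, ρ (x, ξ) =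
      (∫ ξ in S, ρ (x, ξ)) + ∫ ξ in (Metric.ball 0 R)ᶜ, ρ (x, ξ) := by
    rw [← setIntegral_union (disjoint_compl_right.mono_left Set.sdiff_subset)
      measurableSet_ball.compl hρ.integrableOn hρ.integrableOn]
    congr 2
    ext ξ
    have := @hsub ξ
    simp only [Set.mem_compl_iff, Set.mem_union, Set.mem_sdiff]
    tauto
  have h4 : ∀ j, ∫ ξ in S, k j (x, ξ) = _ := fun j =>
    setIntegral_annulus_of_homogeneous (s j) (fun ξ => k j (x, ξ)) (h.homogeneous j x hx) R
  rw [h1, h2, h3]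
  simp only [h4]
  ring

lemma exists_bound_tail (h : HasFibreExpansion U g N s k ρ r) {K : Set (Eucl n)}
    (hK : IsCompact K) (hKU : K ⊆ U) :
    ∃ ε : ℝ → ℝ, Tendsto ε atTop (𝓝 0) ∧ ∀ x ∈ K, ∀ R,
      ‖∫ ξ in (Metric.ball 0 R)ᶜ, ρ (x, ξ)‖ ≤ ε R := by
  obtain ⟨C, hC⟩ := h.decay K hK hKU
  refine ⟨fun R => ∫ ξ in (Metric.ball (0 : Eucl n) R)ᶜ, C * (1 + ‖ξ‖) ^ r,
    tendsto_setIntegral_compl_ball ((integrable_one_add_norm_rpow h.order_lt).const_mul C), ?_⟩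
  intro x hx R
  exact norm_integral_le_of_norm_le
    ((integrable_one_add_norm_rpow h.order_lt).const_mul C).integrableOn
    (ae_of_all _ fun ξ => hC x hx ξ)

lemma continuousOn_tail (h : HasFibreExpansion U g N s k ρ r) (hU : IsOpen U) (R : ℝ) :
    ContinuousOn (fun x => ∫ ξ in (Metric.ball 0 R)ᶜ, ρ (x, ξ)) U := by
  refine continuousOn_setIntegral_of_dominated hU measurableSet_ball.compl
    (h.continuousOn_remainder.mono (Set.prod_mono_right (Set.subset_univ _))) fun K hK hKU => ?_
  obtain ⟨C, hC⟩ := h.decay K hK hKU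
  exact ⟨fun ξ => C * (1 + ‖ξ‖) ^ r,
    ((integrable_one_add_norm_rpow h.order_lt).const_mul C).integrableOn, fun x hx ξ _ => hC x hx ξ⟩

/-- The fibrewise finite parts exist, they are continuous in `x`, and integrating them over a
compact set of base points amounts to taking the finite part of the integrated ball integrals: the
expansions of the latter are uniform in `x`. -/
theorem exists_hasFinitePart [NeZero n] (h : HasFibreExpansion U g N s k ρ r) (hU : IsOpen U) :
    ∃ G : Eucl n → ℂ, ContinuousOn G U ∧ (∀ x ∈ U, HasFinitePart (ballIntegral g x) (G x)) ∧
      ∀ K : Set (Eucl n), IsCompact K → K ⊆ U →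
        HasFinitePart (fun R => ∫ x in K, ballIntegral g x R) (∫ x in K, G x) := by
  choose c hc using fun j => exists_hasFinitePart_radialIntegral (s j + n)
  set B : Eucl n → ℂ := fun x => ∫ ξ in Metric.ball 0 2, g (x, ξ) with hB
  set A : ℕ → Eucl n → ℂ := fun j x => ∫ η : Metric.sphere (0 : Eucl n) 1, k j (x, η)
        ∂(volume : Measure (Eucl n)).toSphere with hA
  set T : ℝ → Eucl n → ℂ := fun R x => ∫ ξ in (Metric.ball 0 R)ᶜ, ρ (x, ξ) with hT
  have hBc : ContinuousOn B U := by
    have : B = fun x => ∫ ξ in Metric.closedBall 0 2, g (x, ξ) := by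
      ext x
      exact setIntegral_congr_set
        (ae_eq_of_subset_of_measure_ge Metric.ball_subset_closedBall
          (by rw [Measure.addHaar_closedBall_eq_addHaar_ball]) measurableSet_ball.nullMeasurableSet
          measure_closedBall_lt_top.ne)
    rw [this]
    exact continuousOn_setIntegral_of_isCompact hU measurableSet_closedBall
      (isCompact_closedBall _ _) (h.continuousOn.mono (Set.prod_mono_right (Set.subset_univ _)))
  have hAc : ∀ j, ContinuousOn (A j) U := by
    intro j
    have := continuousOn_setIntegral_of_isCompact (μ := (volume : Measure (Eucl n)).toSphere) hU
      MeasurableSet.univ isCompact_univ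
      (F := fun q : Eucl n × Metric.sphere (0 : Eucl n) 1 => k j (q.1, q.2))
      ((h.continuousOn_component j).comp (by fun_prop) fun q hq => ⟨hq.1, by
        simpa using ne_zero_of_mem_unit_sphere q.2⟩)
    simpa using this
  have hTc : ∀ R, ContinuousOn (T R) U := h.continuousOn_tail hU
  have hexp : ∀ x ∈ U, ∀ R, 2 ≤ R → ballIntegral g x R =
      B x + ∑ j ∈ Finset.range N, A j x * radialIntegral (s j + n) R + T 2 x - T R x :=
    fun x hx R hR => h.ballIntegral_eq hx hR
  have htail : ∀ K : Set (Eucl n), IsCompact K → K ⊆ U →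
      ∃ ε : ℝ → ℝ, Tendsto ε atTop (𝓝 0) ∧ ∀ x ∈ K, ∀ R, ‖T R x‖ ≤ ε R :=
    fun K hK hKU => h.exists_bound_tail hK hKU
  clear_value A B T
  refine ⟨fun x => B x + ∑ j ∈ Finset.range N, A j x * c j + T 2 x, ?_, ?_, ?_⟩
  · exact (hBc.add (continuousOn_finsetSum _ fun j _ => (hAc j).mul continuousOn_const)).add (hTc 2)
  · intro x hx
    obtain ⟨ε, hε, hεT⟩ := htail {x} isCompact_singleton (by simpa using hx)
    have h0 : Tendsto (fun R => B x + T 2 x - T R x) atTop (𝓝 (B x + T 2 x - 0)) :=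
      tendsto_const_nhds.sub (squeeze_zero_norm (fun R => hεT x rfl R) hε)
    have h1 := (hasFinitePart_of_tendsto h0).add
      (HasFinitePart.sum (Finset.range N) fun j _ => (hc j).const_mul (A j x))
    have h2 := h1.congr (g := ballIntegral g x) (by
      filter_upwards [eventually_ge_atTop 2] with R hR
      rw [hexp x hx R hR]; ring)
    convert h2 using 1
    ring
  · intro K hK hKU
    have hi : ∀ {f : Eucl n → ℂ}, ContinuousOn f U → IntegrableOn f K := fun hf =>
      (hf.mono hKU).integrableOn_compact hK
    obtain ⟨ε, hε, hεT⟩ := htail K hK hKU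
    have hsum : ∀ c : ℕ → ℂ, IntegrableOn (fun x => ∑ j ∈ Finset.range N, A j x * c j) K :=
      fun c => integrable_finsetSum _ fun j _ => (hi (hAc j)).mul_const _
    have hsplit : ∀ (c : ℕ → ℂ) (f : Eucl n → ℂ), IntegrableOn f K →
        ∫ x in K, (B x + ∑ j ∈ Finset.range N, A j x * c j + f x) =
        (∫ x in K, B x) + ∑ j ∈ Finset.range N, (∫ x in K, A j x) * c j + ∫ x in K, f x := by
      intro c f hf
      have hBs : IntegrableOn (fun x => B x + ∑ j ∈ Finset.range N, A j x * c j) K :=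
        (hi hBc).add (hsum c)
      rw [integral_add hBs hf, integral_add (hi hBc) (hsum c),
        integral_finsetSum _ fun j _ => (hi (hAc j)).mul_const _]
      simp only [integral_mul_const]
    have hT0 : Tendsto (fun R => ∫ x in K, T R x) atTop (𝓝 0) := by
      refine squeeze_zero_norm (fun R => norm_setIntegral_le_of_norm_le_const
        hK.measure_lt_top fun x hx => hεT x hx R) ?_
      simpa using hε.mul_const _
    have h0 : Tendsto (fun R => (∫ x in K, B x) + (∫ x in K, T 2 x) - ∫ x in K, T R x) atTop
        (𝓝 ((∫ x in K, B x) + (∫ x in K, T 2 x) - 0)) := tendsto_const_nhds.sub hT0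
    have h1 := (hasFinitePart_of_tendsto h0).add
      (HasFinitePart.sum (Finset.range N) fun j _ => (hc j).const_mul (∫ x in K, A j x))
    have h2 := h1.congr (g := fun R => ∫ x in K, ballIntegral g x R) (by
      filter_upwards [eventually_ge_atTop 2] with R hR
      have : ∫ x in K, ballIntegral g x R = ∫ x in K, (B x + ∑ j ∈ Finset.range N,
          A j x * radialIntegral (s j + n) R + (T 2 x - T R x)) :=
        setIntegral_congr_fun hK.measurableSet fun x hx => by
          simp only [hexp x (hKU hx) R hR]; ring
      rw [this, hsplit _ (fun x => T 2 x - T R x) ((hi (hTc 2)).sub (hi (hTc R))),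
        integral_sub (hi (hTc 2)) (hi (hTc R))]
      ring)
    convert h2 using 1
    rw [hsplit _ _ (hi (hTc 2))]
    ring

end HasFibreExpansion

/-! ### Integrals of derivatives -/

/-- The integral of a derivative vanishes. -/
lemma integral_fderiv_eq_zero {E : Type*} [NormedAddCommGroup E] [NormedSpace ℝ E]
    [FiniteDimensional ℝ E] [MeasurableSpace E] [BorelSpace E] {μ : Measure E}
    [μ.IsAddHaarMeasure] {f : E → ℂ} (v : E) (hf : Differentiable ℝ f) (hfi : Integrable f μ)
    (hf' : Integrable (fun x => fderiv ℝ f x v) μ) : ∫ x, fderiv ℝ f x v ∂μ = 0 := by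
  have := integral_mul_fderiv_eq_neg_fderiv_mul_of_integrable (𝕜 := ℂ) (μ := μ)
    (f := fun _ : E => (1 : ℂ)) (g := f) (v := v) (by simp) (by simpa using hf')
    (by simpa using hfi) (by simp) (fun x _ => hf x)
  simpa using this

lemma hasCompactSupport_fderiv_apply {n : ℕ} {F : Type*} [NormedAddCommGroup F] [NormedSpace ℝ F]
    {f : Eucl n → F} (hc : HasCompactSupport f) (v : Eucl n) :
    HasCompactSupport fun ξ => fderiv ℝ f ξ v :=
  (hc.fderiv (𝕜 := ℝ)).comp_left (g := fun L : Eucl n →L[ℝ] F => L v) (by simp)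

lemma integral_fderiv_eq_zero_of_hasCompactSupport {n : ℕ} {f : Eucl n → ℂ} (v : Eucl n)
    (hf : ContDiff ℝ 1 f) (hc : HasCompactSupport f) : ∫ ξ, fderiv ℝ f ξ v = 0 := by
  refine integral_fderiv_eq_zero v (hf.differentiable one_ne_zero)
    (hf.continuous.integrable_of_hasCompactSupport hc) ?_
  exact Continuous.integrable_of_hasCompactSupport
    ((hf.continuous_fderiv one_ne_zero).clm_apply continuous_const)
    (hasCompactSupport_fderiv_apply hc v)

/-- A smooth function on `ℝⁿ` equal to `1` for `|ξ| ≤ 1` and vanishing for `|ξ| ≥ 2`. -/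
def unitBump (n : ℕ) : ContDiffBump (0 : Eucl n) where
  rIn := 1
  rOut := 2
  rIn_pos := one_pos
  rIn_lt_rOut := one_lt_two

lemma contDiff_unitBump (n : ℕ) : ContDiff ℝ 1 (unitBump n) := (unitBump n).contDiff

open scoped Pointwise in
lemma setIntegral_compl_ball_comp_inv_smul {n : ℕ} (f : Eucl n → ℂ) {R : ℝ} (hR : 0 < R) :
    ∫ ξ in (Metric.ball 0 R)ᶜ, f (R⁻¹ • ξ) = (R : ℂ) ^ n * ∫ ξ in (Metric.ball 0 1)ᶜ, f ξ := by
  rw [Measure.setIntegral_comp_smul _ _ _ (inv_ne_zero hR.ne')]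
  have h : R⁻¹ • (Metric.ball (0 : Eucl n) R)ᶜ = (Metric.ball 0 1)ᶜ := by
    ext ξ
    rw [Set.mem_smul_set_iff_inv_smul_mem₀ (inv_ne_zero hR.ne')]
    simp [norm_smul, abs_of_pos hR, hR]
  rw [h, finrank_euclideanSpace_fin, inv_pow, inv_inv, abs_of_pos (by positivity),
    Complex.real_smul]
  push_cast; rfl

/-- The contribution of a homogeneous function to the boundary term: the integrand is the dilation
by `R` of a fixed function, so that the integral is a multiple of a power of `R`. -/
lemma setIntegral_fderiv_bump_smul_homogeneous {n : ℕ} (s : ℂ) {H : Eucl n → ℂ}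
    (hH : ∀ ξ, ξ ≠ 0 → ∀ t : ℝ, 0 < t → H (t • ξ) = (t : ℂ) ^ s * H ξ) (v : Eucl n)
    {R : ℝ} (hR : 0 < R) :
    ∫ ξ in (Metric.ball 0 R)ᶜ, fderiv ℝ (fun η => unitBump n (R⁻¹ • η) • H η) ξ v =
      (∫ ξ in (Metric.ball 0 1)ᶜ, fderiv ℝ (fun η => unitBump n η • H η) ξ v) *
        (R : ℂ) ^ (s - 1 + n) := by
  have hRc : (R : ℂ) ≠ 0 := by exact_mod_cast hR.ne'
  set Q : Eucl n → ℂ := fun η => unitBump n η • H η with hQ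
  have h1 : ∀ ξ, ξ ≠ 0 → fderiv ℝ (fun η => unitBump n (R⁻¹ • η) • H η) ξ v =
      (R : ℂ) ^ (s - 1) * fderiv ℝ Q (R⁻¹ • ξ) v := by
    intro ξ hξ
    have he : (fun η => unitBump n (R⁻¹ • η) • H η) =ᶠ[𝓝 ξ]
        fun η => (R : ℂ) ^ s • Q (R⁻¹ • η) := by
      filter_upwards [isOpen_compl_singleton.mem_nhds hξ] with η hη
      have := hH (R⁻¹ • η) (smul_ne_zero (inv_ne_zero hR.ne') hη) R hR
      rw [smul_smul, mul_inv_cancel₀ hR.ne', one_smul] at this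
      simp only [hQ, this, Complex.real_smul, smul_eq_mul]
      ring
    have hc : (fun η => (R : ℂ) ^ s • Q (R⁻¹ • η)) = (R : ℂ) ^ s • fun η => Q (R⁻¹ • η) := rfl
    rw [he.fderiv_eq, hc, fderiv_const_smul_field, Pi.smul_apply, fderiv_comp_smul]
    simp only [smul_apply, Complex.real_smul, smul_eq_mul]
    rw [Complex.cpow_sub _ _ hRc, Complex.cpow_one]
    push_cast
    field_simp
  have h2 : ∫ ξ in (Metric.ball 0 R)ᶜ, fderiv ℝ (fun η => unitBump n (R⁻¹ • η) • H η) ξ v =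
      ∫ ξ in (Metric.ball 0 R)ᶜ, (R : ℂ) ^ (s - 1) * fderiv ℝ Q (R⁻¹ • ξ) v := by
    refine setIntegral_congr_fun measurableSet_ball.compl fun ξ hξ => h1 ξ ?_
    rintro rfl
    simp [hR] at hξ
  rw [h2, integral_const_mul, setIntegral_compl_ball_comp_inv_smul (fun ξ => fderiv ℝ Q ξ v) hR,
    Complex.cpow_add _ _ hRc, Complex.cpow_natCast]
  ring

lemma integrableOn_fderiv_bump_smul {n : ℕ} {H : Eucl n → ℂ}
    (hH : ContDiffOn ℝ 1 H {0}ᶜ) (v : Eucl n) {R : ℝ} (hR : 0 < R) :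
    IntegrableOn (fun ξ => fderiv ℝ (fun η => unitBump n (R⁻¹ • η) • H η) ξ v)
      (Metric.ball 0 R)ᶜ := by
  set P : Eucl n → ℂ := fun η => unitBump n (R⁻¹ • η) • H η with hP
  have hPd : ContDiffOn ℝ 1 P {0}ᶜ :=
    ((contDiff_unitBump n).comp (contDiff_const_smul R⁻¹)).contDiffOn.smul hH
  have hcont : ContinuousOn (fun ξ => fderiv ℝ P ξ v) {0}ᶜ :=
    (hPd.continuousOn_fderiv_of_isOpen isOpen_compl_singleton le_rfl).clm_apply continuousOn_const
  have hc : IsCompact (Metric.closedBall (0 : Eucl n) (2 * R) \ Metric.ball 0 R) :=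
    (isCompact_closedBall 0 _).diff Metric.isOpen_ball
  have hi : IntegrableOn (fun ξ => fderiv ℝ P ξ v)
      (Metric.closedBall (0 : Eucl n) (2 * R) \ Metric.ball 0 R) := by
    refine (hcont.mono fun ξ hξ => ?_).integrableOn_compact hc
    rintro (rfl : ξ = 0)
    simp [hR] at hξ
  refine hi.of_forall_sdiff_eq_zero measurableSet_ball.compl fun ξ hξ => ?_
  have hξ' : 2 * R < ‖ξ‖ := by
    by_contra! hcon
    exact hξ.2 ⟨by simpa using hcon, hξ.1⟩
  have he : P =ᶠ[𝓝 ξ] fun _ => 0 := by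
    filter_upwards [(isOpen_lt continuous_const continuous_norm).mem_nhds hξ'] with η hη
    have hη' : 2 * R < ‖η‖ := hη
    have : unitBump n (R⁻¹ • η) = 0 := by
      refine (unitBump n).zero_of_le_dist ?_
      rw [dist_zero_right, norm_smul, Real.norm_of_nonneg (inv_nonneg.2 hR.le)]
      change 2 ≤ R⁻¹ * ‖η‖
      rw [le_inv_mul_iff₀ hR]
      linarith
    simp [hP, this]
  rw [he.fderiv_eq]
  simp

lemma contDiff_unitBump_comp_inv_smul (n : ℕ) (R : ℝ) :
    ContDiff ℝ 1 fun η => unitBump n (R⁻¹ • η) :=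
  (contDiff_unitBump n).comp (contDiff_const_smul R⁻¹)

lemma exists_bound_fderiv_unitBump {n : ℕ} (v : Eucl n) :
    ∃ M, ∀ ξ, ‖fderiv ℝ (fun η => unitBump n η) ξ v‖ ≤ M := by
  refine Continuous.bounded_above_of_compact_support
    (f := fun ξ => fderiv ℝ (fun η => unitBump n η) ξ v)
    (((contDiff_unitBump n).continuous_fderiv one_ne_zero).clm_apply continuous_const) ?_
  exact hasCompactSupport_fderiv_apply (unitBump n).hasCompactSupport v

/-- The contribution of the remainder to the boundary term tends to zero. -/
lemma tendsto_setIntegral_fderiv_bump_smul {n : ℕ} {ρ : Eucl n → ℂ} {r C : ℝ} (v : Eucl n)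
    (hρ : ContDiff ℝ 1 ρ) (hr : r < -n) (hb : ∀ ξ, ‖ρ ξ‖ ≤ C * (1 + ‖ξ‖) ^ r)
    (hb' : ∀ ξ, ‖fderiv ℝ ρ ξ v‖ ≤ C * (1 + ‖ξ‖) ^ r) :
    (∀ R : ℝ, 1 ≤ R → Integrable fun ξ => fderiv ℝ (fun η => unitBump n (R⁻¹ • η) • ρ η) ξ v) ∧
    Tendsto (fun R : ℝ => ∫ ξ in (Metric.ball 0 R)ᶜ,
      fderiv ℝ (fun η => unitBump n (R⁻¹ • η) • ρ η) ξ v) atTop (𝓝 0) := by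
  obtain ⟨M, hM⟩ := exists_bound_fderiv_unitBump v
  have hM0 : 0 ≤ M := (norm_nonneg _).trans (hM 0)
  have hgi := integrable_one_add_norm_rpow hr
  have hle : ∀ R : ℝ, 1 ≤ R → ∀ ξ, ‖fderiv ℝ (fun η => unitBump n (R⁻¹ • η) • ρ η) ξ v‖ ≤
      (C + M * C) * (1 + ‖ξ‖) ^ r := by
    intro R hR ξ
    have hφ1 : ‖unitBump n (R⁻¹ • ξ)‖ ≤ 1 := by
      rw [Real.norm_of_nonneg (unitBump n).nonneg]
      exact (unitBump n).le_one
    have hR1 : ‖R⁻¹‖ ≤ 1 := by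
      rw [Real.norm_of_nonneg (by positivity)]
      exact inv_le_one_of_one_le₀ hR
    rw [fderiv_fun_smul ((contDiff_unitBump_comp_inv_smul n R).differentiable one_ne_zero ξ)
        (hρ.differentiable one_ne_zero ξ), fderiv_comp_smul (f := fun η => unitBump n η)]
    simp only [add_apply, smul_apply, ContinuousLinearMap.smulRight_apply, add_mul]
    refine (norm_add_le _ _).trans (add_le_add ?_ ?_)
    · rw [norm_smul]
      exact (mul_le_of_le_one_left (norm_nonneg _) hφ1).trans (hb' ξ)
    · rw [norm_smul, norm_smul, mul_assoc M]
      exact mul_le_mul ((mul_le_of_le_one_left (norm_nonneg _) hR1).trans (hM _)) (hb ξ)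
        (norm_nonneg _) hM0
  refine ⟨fun R hR => (hgi.const_mul (C + M * C)).mono' (Continuous.aestronglyMeasurable
    ((((contDiff_unitBump_comp_inv_smul n R).smul hρ).continuous_fderiv one_ne_zero).clm_apply
      continuous_const)) (ae_of_all _ (hle R hR)), ?_⟩
  refine squeeze_zero_norm' ?_ (tendsto_setIntegral_compl_ball (hgi.const_mul (C + M * C)))
  filter_upwards [eventually_ge_atTop 1] with R hR
  exact norm_integral_le_of_norm_le (hgi.const_mul _).integrableOn (ae_of_all _ (hle R hR))

/-- The boundary term of the integral of a derivative over the ball of radius `R`, written as an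
integral over `|ξ| ≥ R` with the help of the bump function dilated by `R`. -/
lemma setIntegral_ball_fderiv {n : ℕ} {F : Eucl n → ℂ} (v : Eucl n) (hF : ContDiff ℝ 1 F)
    {R : ℝ} (hR0 : 0 < R) :
    ∫ ξ in Metric.ball 0 R, fderiv ℝ F ξ v =
      -∫ ξ in (Metric.ball 0 R)ᶜ, fderiv ℝ (fun η => unitBump n (R⁻¹ • η) • F η) ξ v := by
  set P : Eucl n → ℂ := fun η => unitBump n (R⁻¹ • η) • F η with hP
  have hPd : ContDiff ℝ 1 P := (contDiff_unitBump_comp_inv_smul n R).smul hF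
  have hφc : HasCompactSupport fun η => unitBump n (R⁻¹ • η) :=
    (unitBump n).hasCompactSupport.comp_homeomorph
      (Homeomorph.smulOfNeZero R⁻¹ (inv_ne_zero hR0.ne'))
  have hPc : HasCompactSupport P := hφc.smul_right
  have hPi : Integrable fun ξ => fderiv ℝ P ξ v :=
    Continuous.integrable_of_hasCompactSupport
      ((hPd.continuous_fderiv one_ne_zero).clm_apply continuous_const)
      (hasCompactSupport_fderiv_apply hPc v)
  have h0 := integral_fderiv_eq_zero_of_hasCompactSupport v hPd hPc
  rw [← integral_add_compl measurableSet_ball hPi (s := Metric.ball 0 R)] at h0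
  rw [← eq_neg_of_add_eq_zero_left h0]
  refine setIntegral_congr_fun measurableSet_ball fun ξ hξ => ?_
  have he : P =ᶠ[𝓝 ξ] F := by
    filter_upwards [Metric.isOpen_ball.mem_nhds hξ] with η hη
    have : unitBump n (R⁻¹ • η) = 1 := by
      refine (unitBump n).one_of_mem_closedBall ?_
      rw [mem_closedBall_zero_iff, norm_smul, Real.norm_of_nonneg (inv_nonneg.2 hR0.le)]
      change R⁻¹ * ‖η‖ ≤ 1
      rw [inv_mul_le_iff₀ hR0, mul_one]
      exact (mem_ball_zero_iff.1 hη).le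
    simp [hP, this]
  simp only [he.fderiv_eq]

/-- The integral of a derivative over the ball of radius `R` is a boundary term. If the function is
the sum, for `|ξ| ≥ 1`, of homogeneous functions of degrees `s j` and of an integrable remainder,
then it is a sum of powers `R ^ (s j - 1 + n)` up to `o(1)`. Hence it has finite part zero unless
one of these exponents vanishes. -/
theorem hasFinitePart_setIntegral_fderiv {n : ℕ} {F ρ : Eucl n → ℂ} {H : ℕ → Eucl n → ℂ} {N : ℕ}
    {s : ℕ → ℂ} {r C : ℝ} (v : Eucl n) (hF : ContDiff ℝ 1 F) (hρ : ContDiff ℝ 1 ρ)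
    (hH : ∀ j, ContDiffOn ℝ 1 (H j) {0}ᶜ)
    (hom : ∀ j, ∀ ξ, ξ ≠ 0 → ∀ t : ℝ, 0 < t → H j (t • ξ) = (t : ℂ) ^ s j * H j ξ)
    (hr : r < -n) (hb : ∀ ξ, ‖ρ ξ‖ ≤ C * (1 + ‖ξ‖) ^ r)
    (hb' : ∀ ξ, ‖fderiv ℝ ρ ξ v‖ ≤ C * (1 + ‖ξ‖) ^ r)
    (heq : ∀ ξ, 1 ≤ ‖ξ‖ → F ξ = ∑ j ∈ Finset.range N, H j ξ + ρ ξ)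
    (hs : ∀ j, s j - 1 + n ≠ 0) :
    HasFinitePart (fun R => ∫ ξ in Metric.ball 0 R, fderiv ℝ F ξ v) 0 := by
  obtain ⟨hrem_int, hrem⟩ := tendsto_setIntegral_fderiv_bump_smul v hρ hr hb hb'
  have hmain : ∀ R : ℝ, 2 ≤ R → ∫ ξ in Metric.ball 0 R, fderiv ℝ F ξ v =
      -1 * (∑ j ∈ Finset.range N, (∫ ξ in (Metric.ball 0 1)ᶜ,
        fderiv ℝ (fun η => unitBump n η • H j η) ξ v) * (R : ℂ) ^ (s j - 1 + n) +
      ∫ ξ in (Metric.ball 0 R)ᶜ, fderiv ℝ (fun η => unitBump n (R⁻¹ • η) • ρ η) ξ v) := by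
    intro R hR
    have hR0 : 0 < R := by linarith
    have hout : ∫ ξ in (Metric.ball 0 R)ᶜ, fderiv ℝ (fun η => unitBump n (R⁻¹ • η) • F η) ξ v =
        ∫ ξ in (Metric.ball 0 R)ᶜ, (∑ j ∈ Finset.range N,
          fderiv ℝ (fun η => unitBump n (R⁻¹ • η) • H j η) ξ v +
          fderiv ℝ (fun η => unitBump n (R⁻¹ • η) • ρ η) ξ v) := by
      refine setIntegral_congr_fun measurableSet_ball.compl fun ξ hξ => ?_
      have hξR : R ≤ ‖ξ‖ := by simpa using hξ
      have hξ1 : 1 < ‖ξ‖ := by linarith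
      have hξ0 : ξ ≠ 0 := norm_pos_iff.1 (by linarith)
      have he : (fun η => unitBump n (R⁻¹ • η) • F η) =ᶠ[𝓝 ξ] fun η =>
          ∑ j ∈ Finset.range N, unitBump n (R⁻¹ • η) • H j η + unitBump n (R⁻¹ • η) • ρ η := by
        filter_upwards [(isOpen_lt continuous_const continuous_norm).mem_nhds hξ1] with η hη
        rw [heq η (le_of_lt hη), smul_add, Finset.smul_sum]
      have hd : ∀ j, DifferentiableAt ℝ (fun η => unitBump n (R⁻¹ • η) • H j η) ξ := fun j =>
        ((contDiff_unitBump_comp_inv_smul n R).differentiable one_ne_zero ξ).smul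
          (((hH j).contDiffAt (isOpen_compl_singleton.mem_nhds hξ0)).differentiableAt one_ne_zero)
      have hdρ : DifferentiableAt ℝ (fun η => unitBump n (R⁻¹ • η) • ρ η) ξ :=
        ((contDiff_unitBump_comp_inv_smul n R).smul hρ).differentiable one_ne_zero ξ
      simp only [he.fderiv_eq]
      rw [fderiv_fun_add (DifferentiableAt.fun_sum fun j _ => hd j) hdρ,
        fderiv_fun_sum fun j _ => hd j]
      simp only [add_apply, sum_apply]
    have hHi := fun j => integrableOn_fderiv_bump_smul (hH j) v hR0
    have hHe := fun j => setIntegral_fderiv_bump_smul_homogeneous (s j) (hom j) v hR0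
    rw [setIntegral_ball_fderiv v hF hR0, hout,
      integral_add (integrable_finsetSum _ fun j _ => hHi j)
        (hrem_int R (by linarith)).integrableOn,
      integral_finsetSum _ fun j _ => hHi j, Finset.sum_congr rfl fun j _ => hHe j, neg_one_mul]
  have h1 := (((HasFinitePart.sum (Finset.range N) fun j _ =>
    (hasFinitePart_cpow (hs j)).const_mul (∫ ξ in (Metric.ball 0 1)ᶜ,
        fderiv ℝ (fun η => unitBump n η • H j η) ξ v)).add
          (hasFinitePart_of_tendsto hrem)).const_mul (-1))
  have h2 := h1.congr (g := fun R => ∫ ξ in Metric.ball 0 R, fderiv ℝ F ξ v) (by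
    filter_upwards [eventually_ge_atTop 2] with R hR
    rw [hmain R hR])
  simpa using h2

/-! ### Derivatives of classical symbols -/

section

variable {n : ℕ} {U : Set (Eucl n)}

lemma frame_castAdd (j : Fin n) :
    frame (Fin.castAdd n j) = ((EuclideanSpace.single j 1 : Eucl n), (0 : Eucl n)) :=
  Fin.addCases_left j

lemma frame_natAdd (j : Fin n) :
    frame (Fin.natAdd n j) = ((0 : Eucl n), (EuclideanSpace.single j 1 : Eucl n)) :=
  Fin.addCases_right j

lemma continuousOn_partialD {f : Cot n → ℂ} {S : Set (Cot n)} (hS : IsOpen S)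
    (hf : ContDiffOn ℝ ∞ f S) (i : Fin (n + n)) : ContinuousOn (partialD i f) S :=
  (hf.continuousOn_fderiv_of_isOpen hS (by simp)).clm_apply continuousOn_const

/-- The derivative of a homogeneous function is homogeneous, with the vertical directions scaled
along with `ξ`. -/
lemma IsHomogeneous.fderiv_apply (hU : IsOpen U) {m : ℂ} {h : Cot n → ℂ} (hh : IsHomogeneous U m h)
    {x ξ : Eucl n} (hx : x ∈ U) (hξ : ξ ≠ 0) {t : ℝ} (ht : 0 < t) (v w : Eucl n) :
    fderiv ℝ h (x, t • ξ) (v, t • w) = (t : ℂ) ^ m * fderiv ℝ h (x, ξ) (v, w) := by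
  have hopen : IsOpen (U ×ˢ ({0}ᶜ : Set (Eucl n))) := hU.prod isOpen_compl_singleton
  have hd : ∀ y : Eucl n, y ≠ 0 → DifferentiableAt ℝ h (x, y) := fun y hy =>
    (hh.1.contDiffAt (hopen.mem_nhds (Set.mk_mem_prod hx hy))).differentiableAt (by simp)
  let S : Cot n →L[ℝ] Cot n := (ContinuousLinearMap.fst ℝ _ _).prod
    (t • ContinuousLinearMap.snd ℝ _ _)
  have he : h ∘ S =ᶠ[𝓝 (x, ξ)] (t : ℂ) ^ m • h := by
    filter_upwards [hopen.mem_nhds ⟨hx, hξ⟩] with p hp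
    exact hh.2 p.1 hp.1 p.2 hp.2 t ht
  have hS : S (x, ξ) = (x, t • ξ) := rfl
  have h1 : fderiv ℝ (h ∘ S) (x, ξ) = (fderiv ℝ h (x, t • ξ)).comp S := by
    rw [fderiv_comp _ (by rw [hS]; exact hd _ (smul_ne_zero ht.ne' hξ)) S.differentiableAt,
      S.fderiv, hS]
  have h2 := congrArg (fun L : Cot n →L[ℝ] ℂ => L (v, w)) (h1.symm.trans he.fderiv_eq)
  rw [fderiv_const_smul_field] at h2
  exact h2

/-- The degree of homogeneity lost by the derivative in the `i`-th coordinate: `0` for `x_j` and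
`1` for `ξ_j`. -/
def degreeDrop (i : Fin (n + n)) : ℂ := if n ≤ i.val then 1 else 0

lemma degreeDrop_castAdd (j : Fin n) : degreeDrop (Fin.castAdd n j) = 0 := by
  simp [degreeDrop]

lemma degreeDrop_natAdd (j : Fin n) : degreeDrop (Fin.natAdd n j) = 1 := by
  simp [degreeDrop]

lemma IsHomogeneous.partialD (hU : IsOpen U) {m : ℂ} {h : Cot n → ℂ} (hh : IsHomogeneous U m h)
    (i : Fin (n + n)) {x ξ : Eucl n} (hx : x ∈ U) (hξ : ξ ≠ 0) {t : ℝ} (ht : 0 < t) :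
    partialD i h (x, t • ξ) = (t : ℂ) ^ (m - degreeDrop i) * partialD i h (x, ξ) := by
  induction i using Fin.addCases with
  | left j =>
    simpa [SymbolForms.partialD, frame_castAdd, degreeDrop_castAdd] using
      hh.fderiv_apply hU hx hξ ht (EuclideanSpace.single j 1) 0
  | right j =>
    have htc : (t : ℂ) ≠ 0 := by exact_mod_cast ht.ne'
    have h1 := hh.fderiv_apply hU hx hξ ht 0 (EuclideanSpace.single j 1)
    have h2 : ((0 : Eucl n), t • (EuclideanSpace.single j 1 : Eucl n)) =
        t • frame (Fin.natAdd n j) := by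
      rw [frame_natAdd, Prod.smul_mk, smul_zero]
    rw [h2, map_smul, Complex.real_smul, ← frame_natAdd] at h1
    simp only [SymbolForms.partialD, degreeDrop_natAdd]
    rw [Complex.cpow_sub _ _ htc, Complex.cpow_one]
    field_simp
    rw [mul_comm]
    exact h1

/-- A compactly supported classical symbol is smooth on all of `T*ℝⁿ`. -/
lemma contDiff_of_mem_CScomOrder (hU : IsOpen U) {χ : Cot n → ℝ} {m : ℂ} {f : Cot n → ℂ}
    (hf : f ∈ CScomOrder U χ m) : ContDiff ℝ ∞ f := by
  obtain ⟨⟨h, -, hrem⟩, K, hK, hKU, hfK⟩ := hf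
  have h0 : ContDiffOn ℝ ∞ f (U ×ˢ Set.univ) := by
    have := (hrem 0).1
    exact this.congr fun p _ => by simp [remainder]
  rw [contDiff_iff_contDiffAt]
  intro p
  by_cases hp : p.1 ∈ K
  · exact h0.contDiffAt ((hU.prod isOpen_univ).mem_nhds ⟨hKU hp, trivial⟩)
  · have : f =ᶠ[𝓝 p] fun _ => 0 := by
      filter_upwards [(hK.isClosed.isOpen_compl.preimage continuous_fst).mem_nhds hp] with q hq
      exact hfK q hq
    exact contDiffAt_const.congr_of_eventuallyEq this

lemma partialD_eq_zero_of_notMem {K : Set (Eucl n)} (hK : IsCompact K) {f : Cot n → ℂ}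
    (hfK : ∀ p : Cot n, p.1 ∉ K → f p = 0) (i : Fin (n + n)) {p : Cot n} (hp : p.1 ∉ K) :
    partialD i f p = 0 := by
  have : f =ᶠ[𝓝 p] fun _ => 0 := by
    filter_upwards [(hK.isClosed.isOpen_compl.preimage continuous_fst).mem_nhds hp] with q hq
    exact hfK q hq
  simp [partialD, this.fderiv_eq]

lemma IsSymbol.exists_bound {r : ℝ} {f : Cot n → ℂ} (hf : IsSymbol U r f) {K : Set (Eucl n)}
    (hK : IsCompact K) (hKU : K ⊆ U) :
    ∃ C : ℝ, ∀ x ∈ K, ∀ ξ : Eucl n, ‖f (x, ξ)‖ ≤ C * (1 + ‖ξ‖) ^ r := by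
  obtain ⟨C, hC⟩ := hf.2 [] K hK hKU
  exact ⟨C, fun x hx ξ => by simpa [iterD, fibreCount] using hC x hx ξ⟩

lemma IsSymbol.exists_bound_partialD {r : ℝ} {f : Cot n → ℂ} (hf : IsSymbol U r f)
    (i : Fin (n + n)) {K : Set (Eucl n)} (hK : IsCompact K) (hKU : K ⊆ U) :
    ∃ C : ℝ, ∀ x ∈ K, ∀ ξ : Eucl n, ‖partialD i f (x, ξ)‖ ≤ C * (1 + ‖ξ‖) ^ r := by
  obtain ⟨C, hC⟩ := hf.2 [i] K hK hKU
  refine ⟨|C|, fun x hx ξ => (hC x hx ξ).trans ?_⟩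
  refine mul_le_mul (le_abs_self C) ?_ (by positivity) (abs_nonneg C)
  exact Real.rpow_le_rpow_of_exponent_le (by linarith [norm_nonneg ξ])
    (by linarith [Nat.cast_nonneg (α := ℝ) (fibreCount [i])])

/-- Where the excision function is `1`, a symbol is the sum of its homogeneous components and of
the remainder. -/
lemma eq_sum_add_remainder {χ : Cot n → ℝ} (hχ : IsExcision U χ) (f : Cot n → ℂ)
    (h : ℕ → Cot n → ℂ) (N : ℕ) {x ξ : Eucl n} (hx : x ∈ U) (hξ : 1 ≤ ‖ξ‖) :
    f (x, ξ) = ∑ j ∈ Finset.range N, h j (x, ξ) + remainder χ f h N (x, ξ) := by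
  simp [remainder, hχ.2.2 x hx ξ hξ]

/-- A derivative of a classical symbol has an expansion on the fibres, given by the derivatives of
the homogeneous components. -/
lemma hasFibreExpansion_partialD (hU : IsOpen U) {χ : Cot n → ℝ} (hχ : IsExcision U χ) {m : ℂ}
    {f : Cot n → ℂ} (hf : ContDiff ℝ ∞ f) {h : ℕ → Cot n → ℂ}
    (hh : ∀ j : ℕ, IsHomogeneous U (m - (j : ℂ)) (h j)) {N : ℕ}
    (hrem : IsSymbol U (m.re - (N : ℝ)) (remainder χ f h N)) (hN : m.re - N < -n)
    (i : Fin (n + n)) :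
    HasFibreExpansion U (partialD i f) N (fun j => m - j - degreeDrop i)
      (fun j => partialD i (h j)) (partialD i (remainder χ f h N)) (m.re - N) where
  continuousOn := continuousOn_partialD (hU.prod isOpen_univ) hf.contDiffOn i
  continuousOn_component j := continuousOn_partialD (hU.prod isOpen_compl_singleton) (hh j).1 i
  homogeneous j x hx ξ hξ t ht := (hh j).partialD hU i hx hξ ht
  continuousOn_remainder := continuousOn_partialD (hU.prod isOpen_univ) hrem.1 i
  decay K hK hKU := hrem.exists_bound_partialD i hK hKU
  order_lt := hN
  eq x hx ξ hξ := by
    have hξ0 : ξ ≠ 0 := norm_pos_iff.1 (by linarith)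
    have hd : ∀ j, DifferentiableAt ℝ (h j) (x, ξ) := fun j =>
      ((hh j).1.contDiffAt ((hU.prod isOpen_compl_singleton).mem_nhds
        (Set.mk_mem_prod hx hξ0))).differentiableAt (by simp)
    have hdr : DifferentiableAt ℝ (remainder χ f h N) (x, ξ) :=
      (hrem.1.contDiffAt ((hU.prod isOpen_univ).mem_nhds ⟨hx, trivial⟩)).differentiableAt (by simp)
    have he : f =ᶠ[𝓝 (x, ξ)]
        fun p => ∑ j ∈ Finset.range N, h j p + remainder χ f h N p := by
      filter_upwards [(hU.prod (isOpen_lt continuous_const continuous_norm)).mem_nhds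
        (show (x, ξ) ∈ U ×ˢ {ξ : Eucl n | 1 < ‖ξ‖} from ⟨hx, by simp; linarith⟩)] with p hp
      exact eq_sum_add_remainder hχ f h N hp.1 (le_of_lt hp.2)
    simp only [partialD, he.fderiv_eq]
    rw [fderiv_fun_add (DifferentiableAt.fun_sum fun j _ => hd j) hdr,
      fderiv_fun_sum fun j _ => hd j]
    simp only [add_apply, sum_apply]

/-- By Fubini's theorem, the integrals of a horizontal derivative over the balls of the fibres
cancel when integrated over the base. -/
lemma setIntegral_ballIntegral_partialD_castAdd {f : Cot n → ℂ} (hf : ContDiff ℝ ∞ f)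
    {K : Set (Eucl n)} (hK : IsCompact K) (hfK : ∀ p : Cot n, p.1 ∉ K → f p = 0) (j : Fin n)
    (R : ℝ) : ∫ x in K, ballIntegral (partialD (Fin.castAdd n j) f) x R = 0 := by
  set i := Fin.castAdd n j with hi
  have hc : Continuous (partialD i f) :=
    (hf.continuous_fderiv (by simp)).clm_apply continuous_const
  have hint : Integrable (Function.uncurry fun x ξ => partialD i f (x, ξ))
      ((volume.restrict K).prod (volume.restrict (Metric.ball 0 R))) := by
    rw [Measure.prod_restrict]
    exact (hc.continuousOn.integrableOn_compact (hK.prod (isCompact_closedBall 0 R))).mono_set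
      (Set.prod_mono_right Metric.ball_subset_closedBall)
  simp only [ballIntegral]
  rw [integral_integral_swap hint]
  refine (integral_congr_ae (ae_of_all _ fun ξ => ?_)).trans (integral_zero _ _)
  have hF : ContDiff ℝ ∞ fun x => f (x, ξ) := hf.comp (contDiff_id.prodMk contDiff_const)
  have hFc : HasCompactSupport fun x => f (x, ξ) :=
    HasCompactSupport.intro hK fun x hx => hfK (x, ξ) hx
  have hd : ∀ x, partialD i f (x, ξ) =
      fderiv ℝ (fun x => f (x, ξ)) x (EuclideanSpace.single j 1) := by
    intro x
    have h1 := (HasFDerivAt.comp x (f := fun x => (x, ξ))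
      (hf.differentiable (by simp) (x, ξ)).hasFDerivAt
      ((hasFDerivAt_id x).prodMk (hasFDerivAt_const ξ x))).fderiv
    change fderiv ℝ (fun x => f (x, ξ)) x = _ at h1
    rw [h1, partialD, hi, frame_castAdd]
    simp
  rw [setIntegral_eq_integral_of_forall_compl_eq_zero fun x hx =>
    partialD_eq_zero_of_notMem hK hfK i (p := (x, ξ)) hx]
  simp only [hd]
  exact integral_fderiv_eq_zero_of_hasCompactSupport _ (hF.of_le (by simp)) hFc

/-- On every fibre, the finite part of the integral of a vertical derivative vanishes, unless the
order of the symbol is one of the integers `1 - n, 2 - n, …`. -/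
lemma hasFinitePart_ballIntegral_partialD_natAdd (hU : IsOpen U) {χ : Cot n → ℝ}
    (hχ : IsExcision U χ) {m : ℂ} {f : Cot n → ℂ} (hf : ContDiff ℝ ∞ f) {h : ℕ → Cot n → ℂ}
    (hh : ∀ j : ℕ, IsHomogeneous U (m - (j : ℂ)) (h j)) {N : ℕ}
    (hrem : IsSymbol U (m.re - (N : ℝ)) (remainder χ f h N)) (hN : m.re - N < -n)
    (hm : ∀ j : ℕ, m - j - 1 + n ≠ 0) (j : Fin n) {x : Eucl n} (hx : x ∈ U) :
    HasFinitePart (ballIntegral (partialD (Fin.natAdd n j) f) x) 0 := by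
  set i := Fin.natAdd n j with hi
  have hslice : ∀ {F : Cot n → ℂ} {ξ : Eucl n}, DifferentiableAt ℝ F (x, ξ) →
      fderiv ℝ (fun ξ => F (x, ξ)) ξ (EuclideanSpace.single j 1) = partialD i F (x, ξ) := by
    intro F ξ hF
    have h1 := (hF.hasFDerivAt.comp ξ ((hasFDerivAt_const x ξ).prodMk (hasFDerivAt_id ξ))).fderiv
    change fderiv ℝ (fun ξ => F (x, ξ)) ξ = _ at h1
    rw [h1, partialD, hi, frame_natAdd]
    simp
  have hmk : ContDiff ℝ ∞ fun ξ : Eucl n => (x, ξ) := contDiff_const.prodMk contDiff_id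
  have hremx : ContDiff ℝ ∞ fun ξ => remainder χ f h N (x, ξ) :=
    contDiffOn_univ.1 (hrem.1.comp hmk.contDiffOn fun ξ _ => ⟨hx, trivial⟩)
  obtain ⟨C, hC⟩ := hrem.exists_bound (isCompact_singleton (x := x)) (by simpa using hx)
  obtain ⟨C', hC'⟩ := hrem.exists_bound_partialD i (isCompact_singleton (x := x))
    (by simpa using hx)
  have hpow : ∀ ξ : Eucl n, 0 ≤ (1 + ‖ξ‖) ^ (m.re - N) := fun ξ => by positivity
  have key := hasFinitePart_setIntegral_fderiv (F := fun ξ => f (x, ξ))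
    (ρ := fun ξ => remainder χ f h N (x, ξ)) (H := fun j ξ => h j (x, ξ)) (N := N)
    (s := fun j => m - j) (r := m.re - N) (C := max C C')
    (EuclideanSpace.single j 1 : Eucl n) ((hf.comp hmk).of_le (by simp)) (hremx.of_le (by simp))
    (fun j => ((hh j).1.comp hmk.contDiffOn fun ξ hξ => ⟨hx, hξ⟩).of_le (by simp))
    (fun j ξ hξ t ht => (hh j).2 x hx ξ hξ t ht) hN
    (fun ξ => (hC x rfl ξ).trans (mul_le_mul_of_nonneg_right (le_max_left _ _) (hpow ξ)))
    (fun ξ => by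
      rw [hslice ((hrem.1.contDiffAt ((hU.prod isOpen_univ).mem_nhds
        ⟨hx, trivial⟩)).differentiableAt (by simp))]
      exact (hC' x rfl ξ).trans (mul_le_mul_of_nonneg_right (le_max_right _ _) (hpow ξ)))
    (fun ξ hξ => eq_sum_add_remainder hχ f h N hx hξ) hm
  refine key.congr (Eventually.of_forall fun R => ?_)
  simp only [ballIntegral]
  exact setIntegral_congr_fun measurableSet_ball fun ξ _ => hslice (hf.differentiable (by simp) _)

/-! ### Cut-off integrals of functions on the cotangent bundle -/

/-- The function `g` on `T*U` is continuous, its fibrewise finite parts exist and are integrable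
over `U`, and `v` is the value of its cut-off integral. -/
structure HasCutoffIntegral (U : Set (Eucl n)) (g : Cot n → ℂ) (v : ℂ) : Prop where
  continuousOn : ContinuousOn g (U ×ˢ Set.univ)
  exists_hasFinitePart : ∀ x ∈ U, ∃ c, HasFinitePart (ballIntegral g x) c
  integrableOn : IntegrableOn (fibreCutoffIntegral g) U
  integral_eq : ∫ x in U, fibreCutoffIntegral g x = v

namespace HasCutoffIntegral

lemma congr (hU : IsOpen U) {g g' : Cot n → ℂ} {v : ℂ} (hg : HasCutoffIntegral U g v)
    (h : ∀ x ∈ U, ∀ ξ, g (x, ξ) = g' (x, ξ)) : HasCutoffIntegral U g' v := by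
  have hb : ∀ x ∈ U, ballIntegral g x = ballIntegral g' x := fun x hx => by
    ext R
    simp only [ballIntegral, h x hx]
  have hc : Set.EqOn (fibreCutoffIntegral g) (fibreCutoffIntegral g') U := fun x hx => by
    simp only [fibreCutoffIntegral, hb x hx]
  refine ⟨hg.1.congr fun p hp => (h p.1 hp.1 p.2).symm, fun x hx => ?_,
    hg.3.congr_fun hc hU.measurableSet, ?_⟩
  · rw [← hb x hx]
    exact hg.2 x hx
  · rw [← hg.4]
    exact (setIntegral_congr_fun hU.measurableSet hc).symm

lemma sum (hU : IsOpen U) {ι : Type*} (s : Finset ι) (c : ι → ℂ) {g : ι → Cot n → ℂ}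
    {v : ι → ℂ} (h : ∀ i ∈ s, HasCutoffIntegral U (g i) (v i)) :
    HasCutoffIntegral U (fun p => ∑ i ∈ s, c i * g i p) (∑ i ∈ s, c i * v i) := by
  have hfp : ∀ x ∈ U, HasFinitePart (ballIntegral (fun p => ∑ i ∈ s, c i * g i p) x)
      (∑ i ∈ s, c i * fibreCutoffIntegral (g i) x) := by
    intro x hx
    refine (HasFinitePart.sum s fun i hi => ?_).congr (f := fun R =>
      ∑ i ∈ s, c i * ballIntegral (g i) x R) (Eventually.of_forall fun R => ?_)
    · obtain ⟨d, hd⟩ := (h i hi).2 x hx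
      rw [fibreCutoffIntegral, hd.finitePart_eq]
      exact hd.const_mul (c i)
    · simp only [ballIntegral]
      rw [integral_finsetSum _ fun i hi => (integrableOn_fibre (h i hi).1 hx R).const_mul (c i)]
      simp only [integral_const_mul]
  have hc : Set.EqOn (fun x => ∑ i ∈ s, c i * fibreCutoffIntegral (g i) x)
      (fibreCutoffIntegral fun p => ∑ i ∈ s, c i * g i p) U := fun x hx =>
    (hfp x hx).finitePart_eq.symm
  refine ⟨continuousOn_finsetSum _ fun i hi => continuousOn_const.mul (h i hi).1,
    fun x hx => ⟨_, hfp x hx⟩, ?_, ?_⟩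
  · exact IntegrableOn.congr_fun (integrable_finsetSum _ fun i hi => (h i hi).3.const_mul (c i)) hc
      hU.measurableSet
  · rw [← setIntegral_congr_fun hU.measurableSet hc,
      integral_finsetSum _ fun i hi => (h i hi).3.const_mul (c i)]
    refine Finset.sum_congr rfl fun i hi => ?_
    rw [integral_const_mul, (h i hi).4]

end HasCutoffIntegral

/-- The cut-off integral of a derivative of a compactly supported classical symbol exists. It
vanishes unless the order of the symbol is one of the integers `1 - n, 2 - n, …`. -/
theorem exists_hasCutoffIntegral_partialD (hU : IsOpen U) {χ : Cot n → ℝ} (hχ : IsExcision U χ)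
    {m : ℂ} {f : Cot n → ℂ} (hf : f ∈ CScomOrder U χ m) (i : Fin (n + n)) :
    ∃ v, HasCutoffIntegral U (partialD i f) v ∧ ((∀ j : ℕ, m - j - 1 + n ≠ 0) → v = 0) := by
  have hfd := contDiff_of_mem_CScomOrder hU hf
  obtain ⟨⟨h, hh, hrem⟩, K, hK, hKU, hfK⟩ := hf
  -- there is a coordinate `i`, so the dimension is positive, as polar coordinates require
  have : NeZero n := ⟨by rintro rfl; exact i.elim0⟩
  -- the remainder has to be of order `m.re - N < -n` to be integrable on the fibres
  obtain ⟨N, hN⟩ := exists_nat_gt (m.re + n)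
  have hexp := hasFibreExpansion_partialD hU hχ hfd hh (hrem N) (by linarith) i
  obtain ⟨G, hGc, hGfp, hGK⟩ := hexp.exists_hasFinitePart hU
  have hG : ∀ x ∈ U, fibreCutoffIntegral (partialD i f) x = G x := fun x hx =>
    (hGfp x hx).finitePart_eq
  have hoff : ∀ x, x ∉ K → fibreCutoffIntegral (partialD i f) x = 0 := by
    intro x hx
    refine HasFinitePart.finitePart_eq (hasFinitePart_of_tendsto ?_)
    have : ballIntegral (partialD i f) x = fun _ => 0 := by
      ext R
      simp [ballIntegral, partialD_eq_zero_of_notMem hK hfK i (p := (x, _)) hx]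
    rw [this]
    exact tendsto_const_nhds
  have hKeq : Set.EqOn G (fibreCutoffIntegral (partialD i f)) K := fun x hx => (hG x (hKU hx)).symm
  have hint : IntegrableOn (fibreCutoffIntegral (partialD i f)) U :=
    (((hGc.mono hKU).integrableOn_compact hK).congr_fun hKeq
      hK.measurableSet).of_forall_sdiff_eq_zero hU.measurableSet fun x hx => hoff x hx.2
  refine ⟨_, ⟨hexp.continuousOn, fun x hx => ⟨G x, hGfp x hx⟩, hint, rfl⟩, fun hm => ?_⟩
  induction i using Fin.addCases with
  | left j =>
    rw [setIntegral_eq_of_subset_of_forall_sdiff_eq_zero hU.measurableSet hKU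
      fun x hx => hoff x hx.2, ← setIntegral_congr_fun hK.measurableSet hKeq]
    refine (hGK K hK hKU).unique (hasFinitePart_of_tendsto ?_)
    simp only [setIntegral_ballIntegral_partialD_castAdd hfd hK hfK]
    exact tendsto_const_nhds
  | right j =>
    refine (setIntegral_congr_fun hU.measurableSet fun x hx => ?_).trans (integral_zero _ _)
    exact (hasFinitePart_ballIntegral_partialD_natAdd hU hχ hfd hh (hrem N) (by linarith) hm j
      hx).finitePart_eq

end

/-! ### Exterior derivatives of regularised forms -/

/-- The top coefficient of the exterior derivative is a linear combination, with constant
coefficients, of partial derivatives of the coefficients of the form. -/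
lemma topCoeff_extDeriv_sum {n k : ℕ} (hk : k + 1 = n + n) (A : Finset (Fin k → Fin (n + n)))
    (σ : (Fin k → Fin (n + n)) → Cot n → ℂ) {p : Cot n}
    (hσ : ∀ a ∈ A, DifferentiableAt ℝ (σ a) p) :
    topCoeff hk (extDeriv fun p => ∑ a ∈ A, σ a p • (elementaryForm a)) p =
      ∑ q ∈ (Finset.univ : Finset (Fin (k + 1))) ×ˢ A,
        ((-1) ^ q.1.val * elementaryForm q.2 (q.1.removeNth fun i => frame (Fin.cast hk i))) *
          partialD (Fin.cast hk q.1) (σ q.2) p := by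
  have h1 : fderiv ℝ (fun p => ∑ a ∈ A, σ a p • (elementaryForm a : Cot n [⋀^Fin k]→L[ℝ] ℂ)) p =
      ∑ a ∈ A, (fderiv ℝ (σ a) p).smulRight (elementaryForm a) := by
    exact (HasFDerivAt.fun_sum fun a ha =>
      (hσ a ha).hasFDerivAt.smul_const (elementaryForm a)).fderiv
  rw [topCoeff, coeff, extDeriv, ContinuousAlternatingMap.alternatizeUncurryFin_apply, h1,
    Finset.sum_product]
  refine Finset.sum_congr rfl fun i _ => ?_
  simp only [sum_apply, ContinuousLinearMap.smulRight_apply, Finset.smul_sum,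
    ContinuousAlternatingMap.sum_apply, ContinuousAlternatingMap.smul_apply]
  refine Finset.sum_congr rfl fun a _ => ?_
  simp only [partialD, smul_eq_mul, zsmul_eq_mul]
  push_cast
  ring

/-- The values at which a holomorphic order produces no constant term on the boundary of the
fibres form a codiscrete set. -/
lemma codiscreteWithin_order_ne {n : ℕ} {W : Set ℂ} (hWo : IsOpen W) (hWc : IsConnected W)
    (hW0 : (0 : ℂ) ∈ W) {α : ℂ → ℂ} (hα : DifferentiableOn ℂ α W) (hα0 : deriv α 0 ≠ 0) :
    {z | ∀ j : ℕ, α z - j - 1 + n ≠ 0} ∈ codiscreteWithin W := by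
  have hαa : AnalyticOnNhd ℂ α W := hα.analyticOnNhd hWo
  refine hαa.preimage_mem_codiscreteWithin (s := {c : ℂ | ∀ j : ℕ, c - j - 1 + n ≠ 0}) ?_ ?_
  · intro z hz hconst
    obtain ⟨c, hc⟩ := eventuallyConst_iff_exists_eventuallyEq.1 hconst
    have heq := hαa.eqOn_of_preconnected_of_eventuallyEq (g := fun _ => c)
      analyticOnNhd_const hWc.isPreconnected hz hc
    have : α =ᶠ[𝓝 0] fun _ => c := by
      filter_upwards [hWo.mem_nhds hW0] with w hw using heq hw
    exact hα0 (by rw [this.deriv_eq, deriv_const])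
  · rw [mem_codiscreteWithin]
    intro c _
    -- the excluded values other than `c` are integers, hence form a closed set
    let T : Set ℤ := {i | (i : ℂ) ≠ c ∧ ∃ j : ℕ, (i : ℂ) - j - 1 + n = 0}
    have hemb : Topology.IsClosedEmbedding ((↑) : ℤ → ℂ) := by
      have := Complex.isometry_ofReal.isClosedEmbedding.comp Int.isClosedEmbedding_coe_real
      exact this
    have hT : IsClosed (((↑) : ℤ → ℂ) '' T) := hemb.isClosedMap _ (isClosed_discrete T)
    have hcT : c ∉ ((↑) : ℤ → ℂ) '' T := by
      rintro ⟨i, hi, rfl⟩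
      exact hi.1 rfl
    rw [disjoint_principal_right, mem_nhdsWithin_iff_eventually]
    filter_upwards [hT.isOpen_compl.mem_nhds hcT] with w hw hwc hbad
    obtain ⟨-, hbad⟩ := hbad
    simp only [Set.mem_ofPred_eq, not_forall, not_not] at hbad
    obtain ⟨j, hj⟩ := hbad
    have hwi : (((j : ℤ) + 1 - n : ℤ) : ℂ) = w := by
      push_cast
      linear_combination -hj
    exact hw ⟨(j : ℤ) + 1 - n, ⟨by rw [hwi]; exact hwc, j, by rw [hwi]; exact hj⟩, hwi⟩

/-- For every parameter, the top coefficient of the exterior derivative of a regularised form has a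
cut-off integral, which vanishes outside a discrete set of parameters. -/
theorem exists_hasCutoffIntegral_topCoeff_extDeriv {n : ℕ} {U : Set (Eucl n)} (hU : IsOpen U)
    {χ : Cot n → ℝ} (hχ : IsExcision U χ) {W : Set ℂ} (hWo : IsOpen W) (hWc : IsConnected W)
    (hW0 : (0 : ℂ) ∈ W) {R : (Cot n → ℂ) → ℂ → Cot n → ℂ}
    (hR : IsHolomorphicRegularisation U χ W R) {k : ℕ} {θ : Form n k}
    (hθ : θ ∈ OmegaCScom U χ k) (hk : k + 1 = n + n) :
    ∃ S ∈ codiscreteWithin W, ∀ z ∈ W, ∃ v,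
      HasCutoffIntegral U (topCoeff hk (extDeriv (inducedRegularisation R θ z))) v ∧
        (z ∈ S → v = 0) := by
  classical
  set A : Finset (Fin k → Fin (n + n)) := Finset.univ.filter StrictMono with hA
  have hdec : ∀ a : A, _ := fun a => hR.of_sum (coeff θ a) (hθ a (Finset.mem_filter.1 a.2).2)
  choose r α τ hτ hsum using hdec
  refine ⟨⋂ q : Σ a : A, Fin (r a), {z | ∀ j : ℕ, α q.1 q.2 z - j - 1 + n ≠ 0}, ?_, ?_⟩
  · exact (iInter_mem).2 fun q =>
      codiscreteWithin_order_ne hWo hWc hW0 (hτ q.1 q.2).1.1 (hτ q.1 q.2).2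
  intro z hz
  have hmem : ∀ a l, τ a l z ∈ CScomOrder U χ (α a l z) := fun a l => (hτ a l).1.2.1 z hz
  have hsmooth : ∀ a : A, Differentiable ℝ (R (coeff θ a) z) := by
    intro a
    have : R (coeff θ a) z = fun p => ∑ l, τ a l z p := by
      rw [hsum a z hz]
      ext p
      simp
    rw [this]
    exact Differentiable.fun_sum fun l _ =>
      (contDiff_of_mem_CScomOrder hU (hmem a l)).differentiable (by simp)
  -- each coefficient has derivatives with a cut-off integral
  have hpartial : ∀ (i : Fin (n + n)) (a : A), ∃ v,
      HasCutoffIntegral U (partialD i (R (coeff θ a) z)) v ∧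
        ((∀ l, ∀ j : ℕ, α a l z - j - 1 + n ≠ 0) → v = 0) := by
    intro i a
    choose v hv hv0 using fun l => exists_hasCutoffIntegral_partialD hU hχ (hmem a l) i
    refine ⟨_, (HasCutoffIntegral.sum hU Finset.univ (fun _ => 1) fun l _ => hv l).congr hU ?_, ?_⟩
    · intro x _ ξ
      have : R (coeff θ a) z = fun p => ∑ l, τ a l z p := by
        rw [hsum a z hz]
        ext p
        simp
      rw [this]
      simp only [partialD, one_mul]
      rw [fderiv_fun_sum fun l _ =>
        (contDiff_of_mem_CScomOrder hU (hmem a l)).differentiable (by simp) _, sum_apply]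
    · intro h
      exact Finset.sum_eq_zero fun l _ => by rw [hv0 l (h l), mul_zero]
  choose v hv hv0 using hpartial
  refine ⟨_, (HasCutoffIntegral.sum hU ((Finset.univ : Finset (Fin (k + 1))) ×ˢ A)
    (fun q => (-1) ^ q.1.val * elementaryForm q.2 (q.1.removeNth fun i => frame (Fin.cast hk i)))
    (g := fun q => partialD (Fin.cast hk q.1) (R (coeff θ q.2) z))
    (v := fun q => if hq : q.2 ∈ A then v (Fin.cast hk q.1) ⟨q.2, hq⟩ else 0) ?_).congr hU ?_, ?_⟩
  · intro q hq
    have hqA := (Finset.mem_product.1 hq).2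
    simp only [dif_pos hqA]
    exact hv _ ⟨q.2, hqA⟩
  · intro x _ ξ
    exact (topCoeff_extDeriv_sum hk A (fun a => R (coeff θ a) z)
      fun a ha => hsmooth ⟨a, ha⟩ (x, ξ)).symm
  · intro hzS
    refine Finset.sum_eq_zero fun q hq => ?_
    have hqA := (Finset.mem_product.1 hq).2
    simp only [dif_pos hqA]
    rw [hv0 _ _ fun l => Set.mem_iInter.1 hzS ⟨⟨q.2, hqA⟩, l⟩, mul_zero]

end SymbolForms

end

theorem mainTheorem7 (n : ℕ) (U : Set (SymbolForms.Eucl n)) (hU : IsOpen U)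
    (χ : SymbolForms.Cot n → ℝ) (hχ : SymbolForms.IsExcision U χ)
    (W : Set ℂ) (hWo : IsOpen W) (hWc : IsConnected W) (hW0 : (0 : ℂ) ∈ W)
    (R : (SymbolForms.Cot n → ℂ) → ℂ → SymbolForms.Cot n → ℂ)
    (hR : SymbolForms.IsHolomorphicRegularisation U χ W R)
    (k : ℕ) (θ : SymbolForms.Form n k) (hθ : θ ∈ SymbolForms.OmegaCScom U χ k) :
    (∀ z ∈ W, SymbolForms.CutoffIntegrable U
      (extDeriv (SymbolForms.inducedRegularisation R θ z))) ∧
    MeromorphicOn (fun z => SymbolForms.cutoffIntegral U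
      (extDeriv (SymbolForms.inducedRegularisation R θ z))) W ∧
    (fun z => SymbolForms.cutoffIntegral U
      (extDeriv (SymbolForms.inducedRegularisation R θ z)))
        =ᶠ[Filter.codiscreteWithin W] (fun _ => (0 : ℂ)) := by
  have hvanish : (fun z => SymbolForms.cutoffIntegral U
      (extDeriv (SymbolForms.inducedRegularisation R θ z)))
        =ᶠ[Filter.codiscreteWithin W] (fun _ => (0 : ℂ)) := by
    by_cases hk : k + 1 = n + n
    · obtain ⟨S, hS, h⟩ := SymbolForms.exists_hasCutoffIntegral_topCoeff_extDeriv hU hχ hWo hWc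
        hW0 hR hθ hk
      filter_upwards [hS, Filter.self_mem_codiscreteWithin W] with z hzS hzW
      obtain ⟨v, hv, hv0⟩ := h z hzW
      rw [SymbolForms.cutoffIntegral, dif_pos hk, hv.integral_eq, hv0 hzS]
    · exact Filter.Eventually.of_forall fun z => dif_neg hk
  refine ⟨fun z hz hk => ?_, fun z hz => ?_, hvanish⟩
  · obtain ⟨S, -, h⟩ := SymbolForms.exists_hasCutoffIntegral_topCoeff_extDeriv hU hχ hWo hWc
      hW0 hR hθ hk
    obtain ⟨v, hv, -⟩ := h z hz
    exact ⟨hv.exists_hasFinitePart, hv.integrableOn⟩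
  · -- near `z` the function vanishes except possibly at `z` itself
    have h0 := (mem_codiscreteWithin.1 hvanish) z hz
    rw [Filter.disjoint_principal_right] at h0
    refine (MeromorphicAt.const (0 : ℂ) z).congr ?_
    filter_upwards [h0, mem_nhdsWithin_of_mem_nhds (hWo.mem_nhds hz)] with w hw hwW
    by_contra hne
    exact hw ⟨hwW, fun h => hne h.symm⟩
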